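/- Let $d \ge 1$ be an integer and $\mathbb S^d \subset \mathbb R^{d+1}$ the round unit sphere with Riemannian volume measure $\lambda$. Let $\mathtt{sgn}:[-\infty,\infty]\to\{\pm1\}$ be the sign function with $\mathtt{sgn}(0)=1$, and let $p_H$ be a probability mass function on $\{0,1,2,\dots\}$ with $p_H(h)>0$ for all $h$. Let $q=-d$. Sample $\theta=W$ by drawing $h\sim p_H$ and then a $(d+1)\times h$ matrix $W$ with independent standard Gaussian entries. Let $\mathcal P_\theta$ be the partition of $\mathbb S^d$ induced by $x\mapsto \mathtt{sgn}(W^\top x)\in\{\pm1\}^h$ (the trivial partition if $h=0$), write $\mathcal P_\theta[z]$ for its cell containing $z$, and put $$\alpha(\theta)=\pi^{q}\,p_H(h)^{-1}(-1)^h\binom{q}{h},\qquad K(x,z)=\mathbb E_\theta\big[\alpha(\theta)\,\mathbb I\{x\in\mathcal P_\theta[z]\}\big]\in[0,\infty],$$ where $\binom qh=\frac1{h!}\prod_{j=0}^{h-1}(q-j)$. For training data $D^n=((X_i,Y_i))_{i=1}^n$ in $\mathbb S^d\times\{\pm1\}$ define the weighted infinite ensemble and its classifier by $$\widehat u_n(x)=\sum_{i=1}^n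 Y_i\,K(x,X_i)\in[-\infty,\infty],\qquad \widehat f(x\,\|\,D^n)=\mathtt{sgn}(\widehat u_n(x)).$$ (a sum containing both $+\infty$ and $-\infty$, which needs a repeated point with contradictory labels, is read as $-\infty$). Then the following hold. (a) If $x\notin\{X_1,\dots,X_n\}$, then $\widehat u_n(x)$ is the (absolutely convergent) expectation $\mathbb E_\theta\big[\alpha(\theta)\sum_{i=1}^n Y_i\,\mathbb I\{x\in\mathcal P_\theta[X_i]\}\big]$ , that is, a weighted average over $\theta$ of the functions whose signs are the histogram classifiers over $\mathcal P_\theta$. (b) For every training set in which equal points carry equal labels, $\widehat f(X_i\,\|\,D^n)=Y_i$ for all $i\in\{1,\dots,n\}$. (c) $\widehat f$ has the interpolating-consistent property: let $(X,Y)$ be distributed on $\mathbb S^d\times\{\pm1\}$ such that $X$ has a density with respect to $\lambda$, and let $(X_1,Y_1),(X_2,Y_2),\dots$ be i.i.d. copies of $(X,Y)$, independent of $(X,Y)$. Then, almost surely, $\widehat f(X_i\,\|\,D^n)=Y_i$ for all $n$ and all $i\le n$, and, as $n\to\infty$, $$\Pr\{\widehat f(X\,\|\,D^n)\ne Y \mid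 D^n\}\ \longrightarrow\ \inf_{f:\mathbb S^d\to\{\pm1\}\ \text{measurable}}\Pr\{f(X)\ne Y\}\quad\text{in probability.}$$ -/

import Mathlib

open MeasureTheory ProbabilityTheory Filter
open scoped ENNReal Matrix

namespace InterpolatingEnsemble

/-- The sign function on the extended reals with values in the label set `{±1}`, modelled by `ℤˣ`
(with the convention that the sign of `0` is `+1`). -/
noncomputable def sgn (t : EReal) : ℤˣ := if 0 ≤ t then 1 else -1

/-- The cell `p[x]` of the point `x` in a partition of `M`, a partition being given by its
equivalence relation "lies in the same cell". -/
def cell {M : Type*} (p : Setoid M) (x : M) : Set M := {z | p z x}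

/-- The function `∑ᵢ Yᵢ · 𝕀{x ∈ p[Xᵢ]}` whose sign is the histogram classifier over `p`
for the training data `D = ((Xᵢ, Yᵢ))ᵢ`. -/
noncomputable def histogram {M : Type*} {n : ℕ} (D : Fin n → M × ℤˣ) (p : Setoid M) (x : M) : ℝ :=
  ∑ i, ((D i).2 : ℤ) * (cell p (D i).1).indicator (fun _ => (1 : ℝ)) x

/-- A weighted random partition `(Θ, 𝔓, α)` over `M`. -/
structure WeightedRandomPartition (M : Type*) where
  /-- The parameter space. -/
  Θ : Type
  /-- The σ-algebra of the parameter space. -/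
  measurableSpace : MeasurableSpace Θ
  /-- The partition of `M` with parameter `θ`. -/
  part : Θ → Setoid M
  /-- The distribution of the random parameter. -/
  law : @Measure Θ measurableSpace
  /-- The distribution is a probability measure. -/
  isProbabilityMeasure : IsProbabilityMeasure law
  /-- The weights. -/
  α : Θ → ℝ
  /-- The weights are nonnegative. -/
  α_nonneg : ∀ θ, 0 ≤ α θ

attribute [instance] WeightedRandomPartition.measurableSpace
  WeightedRandomPartition.isProbabilityMeasure

/-- The weighted random partition kernel `K(x, z) = 𝔼_θ [α(θ) · 𝕀{x ∈ p_θ[z]}] ∈ [0, ∞]`. -/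
noncomputable def WeightedRandomPartition.kernel {M : Type*} (rp : WeightedRandomPartition M)
    (x z : M) : ℝ≥0∞ :=
  ∫⁻ θ, ENNReal.ofReal (rp.α θ) * (cell (rp.part θ) z).indicator (fun _ => (1 : ℝ≥0∞)) x ∂rp.law

/-- The weighted infinite ensemble `∑ᵢ Yᵢ · K(x, Xᵢ)`, an extended real number. -/
noncomputable def ensemble {M : Type*} (K : M → M → ℝ≥0∞) {n : ℕ} (D : Fin n → M × ℤˣ) (x : M) :
    EReal :=
  ∑ i, ((((D i).2 : ℤ) : ℝ) : EReal) * (K x (D i).1 : EReal)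

/-- The unit sphere `𝕊^d` in `ℝ^(d+1)`. -/
abbrev Sphere (d : ℕ) : Type := Metric.sphere (0 : EuclideanSpace ℝ (Fin (d + 1))) 1

/-- The Riemannian volume measure of the round sphere `𝕊^d`, that is, its surface measure:
`λ(B) = (d + 1) · Leb {t x | 0 < t < 1, x ∈ B}`. -/
noncomputable def sphereVolume (d : ℕ) : Measure (Sphere d) :=
  (volume : Measure (EuclideanSpace ℝ (Fin (d + 1)))).toSphere

/-- The generalized binomial coefficient `binom(q, h) = (1 / h!) ∏_{j < h} (q - j)`. -/
noncomputable def binom (q : ℝ) (h : ℕ) : ℝ := (∏ j ∈ Finset.range h, (q - j)) / (h.factorial : ℝ)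

theorem binom_sign {q : ℝ} (hq : q < 0) (h : ℕ) : 0 ≤ (-1) ^ h * binom q h := by
  have e : (-1) ^ h * binom q h = (∏ j ∈ Finset.range h, ((j : ℝ) - q)) / (h.factorial : ℝ) := by
    have : ((-1 : ℝ)) ^ h = ∏ _j ∈ Finset.range h, (-1 : ℝ) := by simp
    rw [binom, ← mul_div_assoc, this, ← Finset.prod_mul_distrib]
    congr 1
    exact Finset.prod_congr rfl fun j _ => by ring
  rw [e]
  refine div_nonneg (Finset.prod_nonneg fun j _ => ?_) (by positivity)
  have : (0 : ℝ) ≤ j := by positivity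
  linarith

/-- The product σ-algebra on real matrices. -/
instance matrixMeasurableSpace (m n : ℕ) : MeasurableSpace (Matrix (Fin m) (Fin n) ℝ) :=
  inferInstanceAs (MeasurableSpace (Fin m → Fin n → ℝ))

/-- The law of a `(d+1) × h` matrix with independent standard Gaussian entries. -/
noncomputable def gaussianMatrix (d h : ℕ) : Measure (Matrix (Fin (d + 1)) (Fin h) ℝ) :=
  (Measure.pi fun _ : Fin (d + 1) => Measure.pi fun _ : Fin h => gaussianReal 0 1).map Matrix.of

/-- The law on `⨿_h ℝ^((d+1) × h)` of a random matrix obtained by sampling the number `h` of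
columns from `pH` and then `h` columns of independent standard Gaussian entries. -/
noncomputable def hyperplaneLaw (d : ℕ) (pH : PMF ℕ) :
    Measure (Σ h : ℕ, Matrix (Fin (d + 1)) (Fin h) ℝ) :=
  Measure.sum fun h => pH h • (gaussianMatrix d h).map (Sigma.mk h)

theorem measurable_matrix_of {m n : ℕ} :
    Measurable (Matrix.of : (Fin m → Fin n → ℝ) → Matrix (Fin m) (Fin n) ℝ) :=
  measurable_id

theorem measurable_sigma_mk (d h : ℕ) :
    Measurable (Sigma.mk h : _ → Σ h : ℕ, Matrix (Fin (d + 1)) (Fin h) ℝ) :=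
  Measurable.of_le_map (iInf_le _ h)

theorem isProbabilityMeasure_hyperplaneLaw (d : ℕ) (pH : PMF ℕ) :
    IsProbabilityMeasure (hyperplaneLaw d pH) := by
  have hG : ∀ h, IsProbabilityMeasure ((gaussianMatrix d h).map
      (Sigma.mk h : _ → Σ h : ℕ, Matrix (Fin (d + 1)) (Fin h) ℝ)) := fun h => by
    have : IsProbabilityMeasure (gaussianMatrix d h) :=
      Measure.isProbabilityMeasure_map measurable_matrix_of.aemeasurable
    exact Measure.isProbabilityMeasure_map (measurable_sigma_mk d h).aemeasurable
  refine ⟨?_⟩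
  rw [hyperplaneLaw, Measure.sum_apply _ MeasurableSet.univ]
  simp [pH.tsum_coe]

/-- The weighted random hyperplane arrangement partition of `𝕊^d` with exponent `q < 0` and column
number distribution `pH`: the parameter is a `(d+1) × h` matrix `W`, its partition is the one
induced by `x ↦ sgn (Wᵀ x) ∈ {±1}^h` (so it is trivial for `h = 0`), and its weight is
`π^q · pH(h)⁻¹ · (-1)^h · binom(q, h)`. -/
noncomputable def hyperplaneArrangement (d : ℕ) (q : ℝ) (hq : q < 0) (pH : PMF ℕ) :
    WeightedRandomPartition (Sphere d) where
  Θ := Σ h : ℕ, Matrix (Fin (d + 1)) (Fin h) ℝ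
  measurableSpace := inferInstance
  part W := Setoid.ker fun x : Sphere d => fun j : Fin W.1 => sgn ((W.2ᵀ *ᵥ x.1.ofLp) j : ℝ)
  law := hyperplaneLaw d pH
  isProbabilityMeasure := isProbabilityMeasure_hyperplaneLaw d pH
  α W := Real.pi ^ q * (pH W.1).toReal⁻¹ * ((-1) ^ W.1 * binom q W.1)
  α_nonneg W := mul_nonneg (by positivity) (binom_sign hq W.1)

/-- The weighted random hyperplane arrangement partition of `𝕊^d`, `d ≥ 1`, with `q = -d`. -/
noncomputable abbrev hilbertArrangement (d : ℕ) (hd : 0 < d) (pH : PMF ℕ) :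
    WeightedRandomPartition (Sphere d) :=
  hyperplaneArrangement d (-(d : ℝ)) (neg_lt_zero.mpr (Nat.cast_pos.mpr hd)) pH

/-- `X` has a density with respect to the reference measure `vol`, where `μX` is its law. -/
def HasDensity {M : Type*} [MeasurableSpace M] (vol μX : Measure M) : Prop :=
  ∃ f : M → ℝ≥0∞, Measurable f ∧ ∀ B, MeasurableSet B → μX B = ∫⁻ x in B, f x ∂vol

/-- The misclassification probability `Pr {f(X) ≠ Y}`, where `μ` is the joint law of `(X, Y)`. -/
noncomputable def risk {M : Type*} [MeasurableSpace M] (μ : Measure (M × ℤˣ)) (f : M → ℤˣ) : ℝ :=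
  μ.real {z | f z.1 ≠ z.2}

/-- The Bayes risk, the infimum of `Pr {f(X) ≠ Y}` over all measurable `f : M → {±1}`. -/
noncomputable def bayesRisk {M : Type*} [MeasurableSpace M] (μ : Measure (M × ℤˣ)) : ℝ :=
  ⨅ f : {f : M → ℤˣ // Measurable f}, risk μ f.1

/-- The interpolating-consistent property of a classifier `fhat`, which maps training data
`D : Fin n → M × {±1}` to a function `M → {±1}`. For all i.i.d. data `(Xᵢ, Yᵢ) = Z i` whose common
law `μ` is such that `X` has a density, (1) almost surely all training points are classified
correctly for every sample size, and (2) the probability that a new pair drawn from `μ` is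
misclassified, which is a random variable through the training data, converges in probability to
the Bayes risk. -/
def InterpolatingConsistent.{u, v} {M : Type v} [MeasurableSpace M] (vol : Measure M)
    (fhat : ∀ n : ℕ, (Fin n → M × ℤˣ) → M → ℤˣ) : Prop :=
  ∀ (Ω : Type u) [MeasurableSpace Ω] (P : Measure Ω) [IsProbabilityMeasure P]
    (μ : Measure (M × ℤˣ)) [IsProbabilityMeasure μ] (Z : ℕ → Ω → M × ℤˣ),
    (∀ i, Measurable (Z i)) → (∀ i, P.map (Z i) = μ) → iIndepFun Z P →
    HasDensity vol μ.fst →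
    (∀ᵐ ω ∂P, ∀ n : ℕ, ∀ i : Fin n, fhat n (fun j => Z j ω) (Z i ω).1 = (Z i ω).2) ∧
    TendstoInMeasure P (fun n ω => risk μ (fhat n fun j => Z j ω)) atTop (fun _ => bayesRisk μ)

end InterpolatingEnsemble

open InterpolatingEnsemble

universe u

/-! The random partition is built so that its weighted kernel is the Hilbert kernel `angle(x,
z)^(-d)`. A Gaussian hyperplane through the origin fails to separate `x` and `z` with probability `t
= 1 - angle(x, z) / π`, and `h` independent ones all fail with probability `t ^ h`. The weight
cancels `pH h`, so the expectation is the binomial series of `(1 - t)^(-d)`, and the factor `π^(-d)`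
removes the remaining power of `π` (`kernel_hilbertArrangement`). This kernel is infinite exactly on
the diagonal. Off the training points everything is therefore integrable, and the ensemble is an
average by linearity; at a training point the infinite term dictates the sign
(`sgn_ensemble_interpolates`).

For consistency, fix `x`. The set where the kernel at `x` is at least `t` is a ball of volume
comparable to `1 / t`, so by Lebesgue differentiation the weight of a random training point with
label `s` has tail of order `1 / t`, with a constant governed by the density of that label at `x`
(`exists_hilbertKernel_tail_bounds`). Such weights have no mean, but after truncation at height `M`
the means of the two labels differ by a multiple of `log M`, while second moments are `O(M)`. With
`M = n log n`, Chebyshev's inequality and a union bound over the truncated points both cost `O(1 /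
log n)`, so the likelier label wins with probability tending to one
(`tendsto_prob_sum_indicator_le`).

The passage from points to risk is soft: the excess risk is at most the integral of the density gap
over the points where the classifier disagrees with the Bayes rule. Its expectation tends to zero by
Tonelli and dominated convergence, and Markov's inequality concludes (`tendstoInMeasure_risk`). -/

namespace InterpolatingEnsemble

open scoped RealInnerProductSpace

/-! ### The probability that a Gaussian hyperplane does not separate two points -/

section GaussianSector

open Real Set

/-- The standard Gaussian measure on `ℝ × ℝ`. -/
noncomputable abbrev gaussianPlane : Measure (ℝ × ℝ) := (gaussianReal 0 1).prod (gaussianReal 0 1)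

theorem gaussianPlane_eq_withDensity :
    gaussianPlane = volume.withDensity
      fun p : ℝ × ℝ => gaussianPDF 0 1 p.1 * gaussianPDF 0 1 p.2 := by
  rw [gaussianPlane, gaussianReal_of_var_ne_zero 0 one_ne_zero,
    prod_withDensity (measurable_gaussianPDF 0 1) (measurable_gaussianPDF 0 1)]
  rfl

/-- Rotation invariance of the planar Gaussian density; the right-hand side is its value at angle
zero. -/
theorem gaussianPDF_mul_polar (r φ : ℝ) :
    gaussianPDF 0 1 (r * cos φ) * gaussianPDF 0 1 (r * sin φ) =
      gaussianPDF 0 1 r * gaussianPDF 0 1 0 := by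
  simp only [gaussianPDF]
  rw [← ENNReal.ofReal_mul (gaussianPDFReal_nonneg _ _ _),
    ← ENNReal.ofReal_mul (gaussianPDFReal_nonneg _ _ _)]
  congr 1
  simp only [gaussianPDFReal, NNReal.coe_one, sub_zero]
  have h : ∀ a b c d : ℝ, a * b * (a * c) = a * a * (b * c) := by intros; ring
  rw [h _ _ _ 0, h _ _ _ 0, ← Real.exp_add, ← Real.exp_add]
  congr 2
  have := cos_sq_add_sin_sq φ
  linear_combination (-r ^ 2 / 2) * this

/-- Polar coordinates separate the variables for a set that is a cone over `A`. The radial factor is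
the same for all such sets, so it need not be evaluated. -/
theorem gaussianPlane_eq_mul_volume {S : Set (ℝ × ℝ)} {A : Set ℝ} (hS : MeasurableSet S)
    (hA : MeasurableSet A)
    (h : ∀ r φ : ℝ, 0 < r → φ ∈ Ioo (-π) π → ((r * cos φ, r * sin φ) ∈ S ↔ φ ∈ A)) :
    gaussianPlane S = (∫⁻ r in Ioi (0 : ℝ), ENNReal.ofReal r *
      (gaussianPDF 0 1 r * gaussianPDF 0 1 0)) * volume (A ∩ Ioo (-π) π) := by
  have hA' : volume (A ∩ Ioo (-π) π) = ∫⁻ φ in Ioo (-π) π, A.indicator 1 φ := by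
    rw [lintegral_indicator_one hA, Measure.restrict_apply hA]
  rw [hA', ← lintegral_prod_mul (Measurable.aemeasurable (by fun_prop))
    (measurable_one.indicator hA).aemeasurable, Measure.prod_restrict, ← Measure.volume_eq_prod,
    gaussianPlane_eq_withDensity, withDensity_apply _ hS, ← lintegral_indicator hS,
    ← lintegral_comp_polarCoord_symm, polarCoord_target]
  refine setLIntegral_congr_fun (measurableSet_Ioi.prod measurableSet_Ioo) ?_
  rintro ⟨r, φ⟩ ⟨hr, hφ⟩
  have hiff := h r φ hr hφ
  simp only [polarCoord_symm_apply, smul_eq_mul]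
  by_cases hmem : φ ∈ A
  · rw [indicator_of_mem (hiff.2 hmem), indicator_of_mem hmem, gaussianPDF_mul_polar]
    simp
  · rw [indicator_of_notMem (fun hc => hmem (hiff.1 hc)), indicator_of_notMem hmem]
    simp

/-- The Gaussian measure of a planar sector is proportional to its opening angle. -/
theorem gaussianPlane_sector {S : Set (ℝ × ℝ)} {A : Set ℝ} (hS : MeasurableSet S)
    (hA : MeasurableSet A)
    (h : ∀ r φ : ℝ, 0 < r → φ ∈ Ioo (-π) π → ((r * cos φ, r * sin φ) ∈ S ↔ φ ∈ A)) :
    gaussianPlane S = volume (A ∩ Ioo (-π) π) / ENNReal.ofReal (2 * π) := by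
  -- The full plane has mass one, which determines the radial factor as `1 / (2π)`.
  have h1 := gaussianPlane_eq_mul_volume MeasurableSet.univ MeasurableSet.univ (by simp)
  rw [measure_univ, univ_inter, Real.volume_Ioo, show π - -π = 2 * π by ring] at h1
  rw [gaussianPlane_eq_mul_volume hS hA h, ENNReal.eq_inv_of_mul_eq_one_left h1.symm, mul_comm,
    div_eq_mul_inv]

theorem cos_sub_pos_iff {θ φ : ℝ} (hθ0 : 0 ≤ θ) (hθ : θ ≤ π) (hφ : φ ∈ Ioo (-π) π) :
    (0 < cos φ ∧ 0 < cos (φ - θ)) ↔ φ ∈ Ioo (θ - π / 2) (π / 2) := by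
  constructor
  · rintro ⟨h1, h2⟩
    have hu : φ < π / 2 := by
      by_contra! hc
      exact h1.not_ge (cos_nonpos_of_pi_div_two_le_of_le hc (by linarith [hφ.2, pi_pos]))
    have hl : -(π / 2) < φ := by
      by_contra! hc
      rw [← cos_neg] at h1
      exact h1.not_ge (cos_nonpos_of_pi_div_two_le_of_le (by linarith)
        (by linarith [hφ.1, pi_pos]))
    refine ⟨?_, hu⟩
    by_contra! hc
    rw [← cos_neg] at h2
    exact h2.not_ge (cos_nonpos_of_pi_div_two_le_of_le (by linarith) (by linarith))
  · rintro ⟨h1, h2⟩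
    exact ⟨cos_pos_of_mem_Ioo ⟨by linarith, h2⟩, cos_pos_of_mem_Ioo ⟨by linarith, by linarith⟩⟩

theorem gaussianPlane_pos_pos {θ : ℝ} (hθ0 : 0 ≤ θ) (hθ : θ ≤ π) :
    gaussianPlane {p | 0 < p.1 ∧ 0 < cos θ * p.1 + sin θ * p.2} =
      ENNReal.ofReal ((1 - θ / π) / 2) := by
  rw [gaussianPlane_sector (A := Ioo (θ - π / 2) (π / 2)) _ measurableSet_Ioo]
  · rw [inter_eq_left.2, Real.volume_Ioo, ← ENNReal.ofReal_div_of_pos (by positivity)]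
    · congr 1
      field_simp
      ring
    · exact Ioo_subset_Ioo (by linarith [pi_pos]) (by linarith [pi_pos])
  · intro r φ hr hφ
    rw [← cos_sub_pos_iff hθ0 hθ hφ]
    have : cos θ * (r * cos φ) + sin θ * (r * sin φ) = r * cos (φ - θ) := by
      rw [cos_sub]; ring
    simp only [mem_ofPred_eq, this, mul_pos_iff_of_pos_left hr]
  · measurability

/-- The reflection `p ↦ -p` preserves the Gaussian measure and exchanges this sector with the
positive one. -/
theorem gaussianPlane_neg_neg {θ : ℝ} (hθ0 : 0 ≤ θ) (hθ : θ ≤ π) :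
    gaussianPlane {p | p.1 < 0 ∧ cos θ * p.1 + sin θ * p.2 < 0} =
      ENNReal.ofReal ((1 - θ / π) / 2) := by
  have hneg : MeasurePreserving (fun x : ℝ => -x) (gaussianReal 0 1) (gaussianReal 0 1) :=
    ⟨measurable_neg, by simpa using gaussianReal_map_neg (μ := 0) (v := 1)⟩
  rw [← gaussianPlane_pos_pos hθ0 hθ, ← (hneg.prod hneg).measure_preimage]
  · congr 1
    ext p
    simp only [preimage_ofPred_eq, mem_ofPred_eq, Prod.map_fst, Prod.map_snd]
    constructor <;> rintro ⟨h1, h2⟩ <;> constructor <;> linarith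
  · exact MeasurableSet.nullMeasurableSet (by measurability)

/-- The kernel of a nonzero linear form is a proper subspace, hence Lebesgue null. -/
theorem gaussianPlane_ae_ne_zero {a b : ℝ} (h : a ≠ 0 ∨ b ≠ 0) :
    ∀ᵐ p ∂gaussianPlane, a * p.1 + b * p.2 ≠ 0 := by
  have hac : gaussianPlane ≪ volume := by
    rw [gaussianPlane_eq_withDensity]; exact withDensity_absolutelyContinuous _ _
  let L : ℝ × ℝ →ₗ[ℝ] ℝ := a • LinearMap.fst ℝ ℝ ℝ + b • LinearMap.snd ℝ ℝ ℝ
  have hL : LinearMap.ker L ≠ ⊤ := by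
    rw [Ne, LinearMap.ker_eq_top]
    intro h0
    have h1 := LinearMap.congr_fun h0 (1, 0)
    have h2 := LinearMap.congr_fun h0 (0, 1)
    simp [L] at h1 h2
    tauto
  have := hac (Measure.addHaar_submodule volume _ hL)
  refine measure_mono_null ?_ this
  intro p hp
  simpa [L] using hp

theorem sgn_coe_eq_one_iff (t : ℝ) : sgn (t : EReal) = 1 ↔ 0 ≤ t := by
  unfold sgn
  split_ifs with h
  · simpa using h
  · simpa using h

theorem sgn_coe_eq_sgn_coe_iff (s t : ℝ) :
    sgn (s : EReal) = sgn (t : EReal) ↔ (0 ≤ s ↔ 0 ≤ t) := by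
  rw [← sgn_coe_eq_one_iff, ← sgn_coe_eq_one_iff]
  rcases Int.units_eq_one_or (sgn (s : EReal)) with h | h <;>
    rcases Int.units_eq_one_or (sgn (t : EReal)) with h' | h' <;> simp [h, h']

/-- Up to two null lines, where the convention for `sgn 0` would matter, the signs agree on two
opposite sectors of equal mass. -/
theorem gaussianPlane_sgn_eq {θ : ℝ} (hθ0 : 0 ≤ θ) (hθ : θ ≤ π) :
    gaussianPlane {p | sgn (p.1 : EReal) = sgn ((cos θ * p.1 + sin θ * p.2 : ℝ) : EReal)} =
      ENNReal.ofReal (1 - θ / π) := by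
  have hae : {p : ℝ × ℝ | sgn (p.1 : EReal) = sgn ((cos θ * p.1 + sin θ * p.2 : ℝ) : EReal)}
      =ᵐ[gaussianPlane] ({p | 0 < p.1 ∧ 0 < cos θ * p.1 + sin θ * p.2} ∪
        {p | p.1 < 0 ∧ cos θ * p.1 + sin θ * p.2 < 0} : Set (ℝ × ℝ)) := by
    have h1 : ∀ᵐ p ∂gaussianPlane, (1 : ℝ) * p.1 + 0 * p.2 ≠ 0 :=
      gaussianPlane_ae_ne_zero (Or.inl one_ne_zero)
    have h2 : ∀ᵐ p ∂gaussianPlane, cos θ * p.1 + sin θ * p.2 ≠ 0 := by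
      refine gaussianPlane_ae_ne_zero ?_
      by_contra! hc
      have := cos_sq_add_sin_sq θ
      rw [hc.1, hc.2] at this
      norm_num at this
    filter_upwards [h1, h2] with p hp1 hp2
    rw [one_mul, zero_mul, add_zero] at hp1
    apply propext
    change sgn (p.1 : EReal) = sgn ((cos θ * p.1 + sin θ * p.2 : ℝ) : EReal) ↔
      (0 < p.1 ∧ 0 < cos θ * p.1 + sin θ * p.2) ∨ (p.1 < 0 ∧ cos θ * p.1 + sin θ * p.2 < 0)
    rw [sgn_coe_eq_sgn_coe_iff]
    rcases lt_or_gt_of_ne hp1 with h | h <;> rcases lt_or_gt_of_ne hp2 with h' | h' <;>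
      simp [h, h', h.le, h'.le, h.not_gt, h'.not_gt, h.not_ge, h'.not_ge]
  rw [measure_congr hae, measure_union, gaussianPlane_pos_pos hθ0 hθ, gaussianPlane_neg_neg hθ0 hθ,
    ← ENNReal.ofReal_add, add_halves]
  · exact div_nonneg (sub_nonneg.2 (div_le_one_of_le₀ hθ pi_pos.le)) two_pos.le
  · exact div_nonneg (sub_nonneg.2 (div_le_one_of_le₀ hθ pi_pos.le)) two_pos.le
  · rw [Set.disjoint_left]
    rintro p ⟨h1, _⟩ ⟨h2, _⟩
    linarith
  · measurability

end GaussianSector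

/-! ### Reduction of the separation probability to the plane -/

section GaussianHyperplane

open Real Set InnerProductGeometry

/-- In dimension at least two, a unit vector `z` has polar coordinates with respect to any unit
vector `x`. -/
theorem exists_polar_decomposition {E : Type*} [NormedAddCommGroup E] [InnerProductSpace ℝ E]
    (hE : 1 < Module.finrank ℝ E) {x z : E} (hx : ‖x‖ = 1)
    (hz : ‖z‖ = 1) :
    ∃ u : E, ‖u‖ = 1 ∧ ⟪x, u⟫ = 0 ∧ z = cos (angle x z) • x + sin (angle x z) • u := by
  have hcos : cos (angle x z) = ⟪x, z⟫ := by rw [cos_angle, hx, hz]; simp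
  set v := z - cos (angle x z) • x with hv
  have hxv : ⟪x, v⟫ = 0 := by
    rw [hv, inner_sub_right, inner_smul_right, real_inner_self_eq_norm_sq, hx, hcos]; ring
  have hzv : z = cos (angle x z) • x + v := by rw [hv]; abel
  have hnv : ‖v‖ = sin (angle x z) := by
    have h1 : ‖v‖ ^ 2 = sin (angle x z) ^ 2 := by
      have h2 : ⟪z, z⟫ = 1 := by rw [real_inner_self_eq_norm_sq, hz]; norm_num
      rw [← real_inner_self_eq_norm_sq, sin_sq, hcos, hv, hcos]
      simp only [inner_sub_left, inner_sub_right, inner_smul_left, inner_smul_right,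
        real_inner_self_eq_norm_sq, hx, hz, real_inner_comm x z]
      simp
      ring
    exact (pow_left_inj₀ (norm_nonneg _) (sin_angle_nonneg _ _) two_ne_zero).1 h1
  -- If `z = ±x`, the sine vanishes and any unit vector orthogonal to `x` will do; only here is
  -- dimension at least two needed.
  by_cases hv0 : v = 0
  · obtain ⟨w, hw, hw0⟩ : ∃ w ∈ (ℝ ∙ x)ᗮ, w ≠ 0 := by
      have : (ℝ ∙ x)ᗮ ≠ ⊥ := by
        rw [Ne, Submodule.orthogonal_eq_bot_iff]
        intro h
        have h1 := finrank_span_singleton (K := ℝ) (v := x) (by rintro rfl; simp at hx)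
        rw [h, finrank_top] at h1
        omega
      exact Submodule.exists_mem_ne_zero_of_ne_bot this
    refine ⟨‖w‖⁻¹ • w, ?_, ?_, ?_⟩
    · rw [norm_smul, norm_inv, norm_norm, inv_mul_cancel₀ (norm_ne_zero_iff.2 hw0)]
    · rw [inner_smul_right, Submodule.mem_orthogonal_singleton_iff_inner_right.1 hw, mul_zero]
    · rw [← hnv, hv0, norm_zero, zero_smul, ← hv0]; exact hzv
  · refine ⟨‖v‖⁻¹ • v, ?_, ?_, ?_⟩
    · rw [norm_smul, norm_inv, norm_norm, inv_mul_cancel₀ (norm_ne_zero_iff.2 hv0)]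
    · rw [inner_smul_right, hxv, mul_zero]
    · rw [← hnv, smul_smul, mul_inv_cancel₀ (norm_ne_zero_iff.2 hv0), one_smul]; exact hzv

variable {E : Type*} [NormedAddCommGroup E] [InnerProductSpace ℝ E] [FiniteDimensional ℝ E]
  [MeasurableSpace E] [BorelSpace E]

/-- The two coordinates are jointly Gaussian with covariance `⟪x, u⟫ = 0`, hence independent, and
unit norms make both marginals standard. -/
theorem stdGaussian_map_inner_pair {x u : E} (hx : ‖x‖ = 1) (hu : ‖u‖ = 1) (hxu : ⟪x, u⟫ = 0) :
    (stdGaussian E).map (fun g => (⟪x, g⟫, ⟪u, g⟫)) = gaussianPlane := by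
  have hlaw : HasGaussianLaw (fun g : E => (⟪x, g⟫, ⟪u, g⟫)) (stdGaussian E) :=
    (IsGaussian.hasGaussianLaw_id (μ := stdGaussian E)).map_fun
      ((innerSL ℝ x).prod (innerSL ℝ u))
  have hmarg : ∀ v : E, ‖v‖ = 1 →
      (stdGaussian E).map (fun g => ⟪v, g⟫) = gaussianReal 0 1 := by
    intro v hv
    have hl : HasGaussianLaw (fun g : E => ⟪v, g⟫) (stdGaussian E) :=
      (IsGaussian.hasGaussianLaw_id (μ := stdGaussian E)).map_fun (innerSL ℝ v)
    have h1 := integral_strongDual_stdGaussian (innerSL ℝ v)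
    have h2 := variance_dual_stdGaussian (innerSL ℝ v)
    rw [innerSL_apply_norm, hv] at h2
    have h1' : ∫ g, ⟪v, g⟫ ∂(stdGaussian E) = 0 := h1
    have h2' : Var[fun g => ⟪v, g⟫; stdGaussian E] = 1 := by simpa using h2
    rw [hl.map_eq_gaussianReal, h1', h2', Real.toNNReal_one]
  have hcov : cov[fun g => ⟪x, g⟫, fun g => ⟪u, g⟫; stdGaussian E] = 0 := by
    rw [← covarianceBilin_apply_eq_cov IsGaussian.memLp_two_id, covarianceBilin_stdGaussian]
    exact hxu
  have hind := hlaw.indepFun_of_covariance_eq_zero hcov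
  rw [(indepFun_iff_map_prod_eq_prod_map_map (by fun_prop) (by fun_prop)).1 hind,
    hmarg x hx, hmarg u hu]

/-- A Gaussian hyperplane through the origin leaves two unit vectors on the same side with
probability `1 - θ / π`, where `θ` is their angle. -/
theorem stdGaussian_sgn_inner_eq (hE : 1 < Module.finrank ℝ E) {x z : E} (hx : ‖x‖ = 1)
    (hz : ‖z‖ = 1) :
    stdGaussian E {g | sgn (⟪x, g⟫ : EReal) = sgn (⟪z, g⟫ : EReal)} =
      ENNReal.ofReal (1 - angle x z / π) := by
  obtain ⟨u, hu, hxu, hzu⟩ := exists_polar_decomposition hE hx hz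
  rw [← gaussianPlane_sgn_eq (angle_nonneg x z) (angle_le_pi x z),
    ← stdGaussian_map_inner_pair hx hu hxu, Measure.map_apply]
  · congr 1
    ext g
    simp only [preimage_ofPred_eq, mem_ofPred_eq]
    have : ⟪z, g⟫ = cos (angle x z) * ⟪x, g⟫ + sin (angle x z) * ⟪u, g⟫ := by
      conv_lhs => rw [hzu]
      simp [inner_add_left, inner_smul_left]
    rw [this]
  · fun_prop
  · simp only [sgn_coe_eq_sgn_coe_iff]
    exact MeasurableSet.iff (measurableSet_le (by fun_prop) (by fun_prop))
      (measurableSet_le (by fun_prop) (by fun_prop))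

end GaussianHyperplane

/-! ### The kernel of the hyperplane arrangement with exponent `-d` -/

section Kernel

open InnerProductGeometry

/-- The signs turn the falling product of a negative number into a rising factorial. -/
theorem neg_one_pow_mul_binom_neg (n h : ℕ) :
    (-1) ^ h * binom (-((n + 1 : ℕ) : ℝ)) h = ((h + n).choose n : ℝ) := by
  have e : (-1) ^ h * binom (-((n + 1 : ℕ) : ℝ)) h =
      (∏ j ∈ Finset.range h, (((n + 1 : ℕ) : ℝ) + j)) / (h.factorial : ℝ) := by
    have : ((-1 : ℝ)) ^ h = ∏ _j ∈ Finset.range h, (-1 : ℝ) := by simp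
    rw [binom, ← mul_div_assoc, this, ← Finset.prod_mul_distrib]
    congr 1
    exact Finset.prod_congr rfl fun j _ => by ring
  rw [e, div_eq_iff (by positivity)]
  have h1 := Nat.ascFactorial_eq_factorial_mul_choose n h
  rw [Nat.ascFactorial_eq_prod_range] at h1
  have h2 : (h + n).choose n = (n + h).choose h := by
    rw [add_comm h n]; exact Nat.choose_symm_add
  rw [h2, mul_comm]
  exact_mod_cast h1

/-- The binomial series `∑ₕ C(h + n, n) tʰ = (1 - t)^(-(n + 1))` for `t ∈ [0, 1]`, as an identity
between extended nonnegative reals. -/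
theorem tsum_choose_mul_pow (n : ℕ) {t : ℝ} (ht0 : 0 ≤ t) (ht : t ≤ 1) :
    ∑' h : ℕ, ENNReal.ofReal ((h + n).choose n : ℝ) * ENNReal.ofReal t ^ h =
      (ENNReal.ofReal (1 - t) ^ (n + 1))⁻¹ := by
  rcases ht.lt_or_eq with h1 | rfl
  · have hs := hasSum_choose_mul_geometric_of_norm_lt_one n (r := t)
      (by rwa [Real.norm_of_nonneg ht0])
    rw [← ENNReal.ofReal_pow (by linarith), ← ENNReal.ofReal_inv_of_pos (pow_pos (by linarith) _),
      ← one_div, ← hs.tsum_eq, ENNReal.ofReal_tsum_of_nonneg (fun h => by positivity) hs.summable]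
    refine tsum_congr fun h => ?_
    rw [ENNReal.ofReal_mul (by positivity), ENNReal.ofReal_pow ht0]
  -- At `t = 1` the right side is `0⁻¹ = ⊤`, and the series diverges because every term is at least
  -- one.
  · simp only [ENNReal.ofReal_one, one_pow, mul_one, sub_self, ENNReal.ofReal_zero, ne_eq,
      Nat.add_eq_zero_iff, one_ne_zero, and_false, not_false_eq_true, zero_pow, ENNReal.inv_zero]
    refine top_unique ?_
    rw [← ENNReal.tsum_const_eq_top_of_ne_zero (α := ℕ) (one_ne_zero (α := ℝ≥0∞))]
    refine ENNReal.tsum_le_tsum fun h => ?_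
    rw [ENNReal.one_le_ofReal]
    exact_mod_cast Nat.choose_pos (Nat.le_add_left n h)

theorem measurable_sigma_iff {ι γ : Type*} {β : ι → Type*} [∀ i, MeasurableSpace (β i)]
    [MeasurableSpace γ] {f : (Σ i, β i) → γ} :
    Measurable f ↔ ∀ i, Measurable fun b => f ⟨i, b⟩ := by
  constructor
  · exact fun h i => h.comp (Measurable.of_le_map (iInf_le _ i))
  · exact fun h s hs => MeasurableSpace.measurableSet_iInf.2 fun i => h i hs

/-- Exchanging rows and columns of a matrix of independent entries. -/
theorem map_swap_pi_pi {ι κ : Type*} [Fintype ι] [Fintype κ] (ν : Measure ℝ)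
    [IsProbabilityMeasure ν] :
    (Measure.pi fun _ : ι => Measure.pi fun _ : κ => ν).map (Function.swap : _ → κ → ι → ℝ) =
      Measure.pi fun _ : κ => Measure.pi fun _ : ι => ν := by
  have hmeas : Measurable (Function.swap : (ι → κ → ℝ) → κ → ι → ℝ) :=
    measurable_pi_lambda _ fun j => measurable_pi_lambda _ fun i =>
      (measurable_pi_apply j).comp (measurable_pi_apply i)
  symm
  -- It suffices to compare the measures on products of boxes, whose preimages under the swap are
  -- again products of boxes.
  refine Measure.pi_eq_generateFrom
    (C := fun _ => Set.pi Set.univ '' Set.pi Set.univ fun _ : ι => {s : Set ℝ | MeasurableSet s})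
    (fun _ => generateFrom_pi) (fun _ => isPiSystem_pi) (fun _ => ?_) ?_
  · exact
      { set := fun _ => Set.univ
        set_mem := fun _ => ⟨fun _ => Set.univ, fun _ _ => by simp, Set.pi_univ _⟩
        finite := fun _ => measure_lt_top _ _
        spanning := Set.iUnion_const _ }
  · intro s hs
    choose t ht hts using hs
    have hpre : (Function.swap : (ι → κ → ℝ) → κ → ι → ℝ) ⁻¹' Set.pi Set.univ s =
        Set.pi Set.univ fun i => Set.pi Set.univ fun j => t j i := by
      ext W
      simp only [Set.mem_preimage, Set.mem_univ_pi, ← hts, Function.swap]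
      exact forall_comm
    rw [Measure.map_apply hmeas, hpre, Measure.pi_pi]
    · simp_rw [← hts, Measure.pi_pi]
      exact Finset.prod_comm
    · refine MeasurableSet.univ_pi fun j => ?_
      rw [← hts]
      exact MeasurableSet.univ_pi fun i => ht j i (Set.mem_univ i)

/-- The columns of a Gaussian matrix are independent standard Gaussian vectors. -/
theorem gaussianMatrix_forall_col (d h : ℕ) {S : Set (EuclideanSpace ℝ (Fin (d + 1)))}
    (hS : MeasurableSet S) :
    gaussianMatrix d h {W | ∀ j, WithLp.toLp 2 (fun i => W i j) ∈ S} =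
      stdGaussian (EuclideanSpace ℝ (Fin (d + 1))) S ^ h := by
  have htoLp : Measurable (WithLp.toLp 2 : (Fin (d + 1) → ℝ) → EuclideanSpace ℝ (Fin (d + 1))) :=
    by fun_prop
  have hset : MeasurableSet (Set.pi Set.univ fun _ : Fin h =>
      (WithLp.toLp 2 : (Fin (d + 1) → ℝ) → EuclideanSpace ℝ (Fin (d + 1))) ⁻¹' S) :=
    MeasurableSet.univ_pi fun _ => htoLp hS
  have hswap : Measurable (Function.swap : (Fin (d + 1) → Fin h → ℝ) → Fin h → Fin (d + 1) → ℝ) :=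
    measurable_pi_lambda _ fun j => measurable_pi_lambda _ fun i =>
      (measurable_pi_apply j).comp (measurable_pi_apply i)
  have h1 : gaussianMatrix d h {W | ∀ j, WithLp.toLp 2 (fun i => W i j) ∈ S} =
      ((Measure.pi fun _ : Fin (d + 1) => Measure.pi fun _ : Fin h => gaussianReal 0 1).map
        (Function.swap : _ → Fin h → Fin (d + 1) → ℝ)) (Set.pi Set.univ fun _ : Fin h =>
          (WithLp.toLp 2 : (Fin (d + 1) → ℝ) → EuclideanSpace ℝ (Fin (d + 1))) ⁻¹' S) := by
    have hpre : {W : Matrix (Fin (d + 1)) (Fin h) ℝ | ∀ j, WithLp.toLp 2 (fun i => W i j) ∈ S} =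
        (Function.swap : (Fin (d + 1) → Fin h → ℝ) → Fin h → Fin (d + 1) → ℝ) ⁻¹'
          (Set.pi Set.univ fun _ : Fin h =>
          (WithLp.toLp 2 : (Fin (d + 1) → ℝ) → EuclideanSpace ℝ (Fin (d + 1))) ⁻¹' S) := by
      ext W
      exact Set.mem_univ_pi.symm
    rw [hpre, Measure.map_apply hswap hset]
    exact Measure.map_apply measurable_matrix_of (hswap hset)
  rw [h1, map_swap_pi_pi, Measure.pi_pi, Finset.prod_const, Finset.card_univ, Fintype.card_fin,
    ← map_pi_eq_stdGaussian, Measure.map_apply htoLp hS]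

variable {d : ℕ}

/-- The set of hyperplane arrangements that do not separate two points of the sphere. -/
def sameSide (x z : Sphere d) : Set (Σ h : ℕ, Matrix (Fin (d + 1)) (Fin h) ℝ) :=
  {W | ∀ j, WithLp.toLp 2 (fun i => W.2 i j) ∈ {g : EuclideanSpace ℝ (Fin (d + 1)) |
    sgn (⟪x.1, g⟫ : EReal) = sgn (⟪z.1, g⟫ : EReal)}}

/-- The weight of a hyperplane arrangement. -/
noncomputable def hyperplaneWeight (d : ℕ) (q : ℝ) (pH : PMF ℕ)
    (W : Σ h : ℕ, Matrix (Fin (d + 1)) (Fin h) ℝ) : ℝ :=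
  Real.pi ^ q * (pH W.1).toReal⁻¹ * ((-1) ^ W.1 * binom q W.1)

theorem mem_cell_hyperplaneArrangement_iff (q : ℝ) (hq : q < 0) (pH : PMF ℕ) (x z : Sphere d)
    (W : Σ h : ℕ, Matrix (Fin (d + 1)) (Fin h) ℝ) :
    x ∈ cell ((hyperplaneArrangement d q hq pH).part W) z ↔ W ∈ sameSide x z := by
  have hinner : ∀ (y : Sphere d) (j : Fin W.1),
      (W.2ᵀ *ᵥ y.1.ofLp) j = ⟪y.1, WithLp.toLp 2 (fun i => W.2 i j)⟫ := by
    intro y j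
    simp [Matrix.mulVec, dotProduct, PiLp.inner_apply]
  change (fun j : Fin W.1 => sgn ((W.2ᵀ *ᵥ x.1.ofLp) j : ℝ)) =
    (fun j : Fin W.1 => sgn ((W.2ᵀ *ᵥ z.1.ofLp) j : ℝ)) ↔ _
  rw [funext_iff]
  simp only [hinner, sameSide, Set.mem_ofPred_eq]

theorem indicator_cell_hyperplaneArrangement {β : Type*} [Zero β] (q : ℝ) (hq : q < 0)
    (pH : PMF ℕ) (b : β) (x z : Sphere d) (W : Σ h : ℕ, Matrix (Fin (d + 1)) (Fin h) ℝ) :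
    (cell ((hyperplaneArrangement d q hq pH).part W) z).indicator (fun _ => b) x =
      (sameSide x z).indicator (fun _ => b) W := by
  classical
  simp only [Set.indicator_apply, mem_cell_hyperplaneArrangement_iff]

theorem measurableSet_sgn_inner_eq (x z : EuclideanSpace ℝ (Fin (d + 1))) :
    MeasurableSet {g : EuclideanSpace ℝ (Fin (d + 1)) |
        sgn (⟪x, g⟫ : EReal) = sgn (⟪z, g⟫ : EReal)} := by
  simp only [sgn_coe_eq_sgn_coe_iff]
  exact MeasurableSet.iff (measurableSet_le (by fun_prop) (by fun_prop))
    (measurableSet_le (by fun_prop) (by fun_prop))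

theorem measurableSet_sameSide (x z : Sphere d) : MeasurableSet (sameSide x z) := by
  refine MeasurableSpace.measurableSet_iInf.2 fun h => ?_
  change MeasurableSet {W : Matrix (Fin (d + 1)) (Fin h) ℝ |
    ∀ j, WithLp.toLp 2 (fun i => W i j) ∈ {g : EuclideanSpace ℝ (Fin (d + 1)) |
      sgn (⟪x.1, g⟫ : EReal) = sgn (⟪z.1, g⟫ : EReal)}}
  rw [Set.ofPred_forall]
  refine MeasurableSet.iInter fun j => ?_
  have hm : Measurable fun W : Matrix (Fin (d + 1)) (Fin h) ℝ =>
      (WithLp.toLp 2 (fun i => W i j) : EuclideanSpace ℝ (Fin (d + 1))) := by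
    have h2 : Measurable fun W : Matrix (Fin (d + 1)) (Fin h) ℝ => fun i => W i j :=
      measurable_pi_lambda _ fun i => (measurable_pi_apply j).comp (measurable_pi_apply i)
    fun_prop
  exact hm (measurableSet_sgn_inner_eq x.1 z.1)

theorem measurable_hyperplaneWeight (q : ℝ) (pH : PMF ℕ) :
    Measurable (hyperplaneWeight d q pH) :=
  measurable_sigma_iff.2 fun h => by
    change Measurable fun _ => Real.pi ^ q * (pH h).toReal⁻¹ * ((-1) ^ h * binom q h)
    exact measurable_const

theorem kernel_hyperplaneArrangement (q : ℝ) (hq : q < 0) (pH : PMF ℕ) (x z : Sphere d) :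
    (hyperplaneArrangement d q hq pH).kernel x z =
      ∫⁻ W, ENNReal.ofReal (hyperplaneWeight d q pH W) *
        (sameSide x z).indicator (fun _ => (1 : ℝ≥0∞)) W ∂(hyperplaneLaw d pH) := by
  change ∫⁻ W, ENNReal.ofReal (hyperplaneWeight d q pH W) *
    (cell ((hyperplaneArrangement d q hq pH).part W) z).indicator (fun _ => (1 : ℝ≥0∞)) x
      ∂(hyperplaneLaw d pH) = _
  simp_rw [indicator_cell_hyperplaneArrangement]

/-- Columns are independent, and each is the normal of a Gaussian hyperplane. Positivity of `d`
makes the ambient dimension at least two. -/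
theorem gaussianMatrix_sameSide (hd : 0 < d) (x z : Sphere d) (h : ℕ) :
    gaussianMatrix d h ((fun W => ⟨h, W⟩) ⁻¹' sameSide x z) =
      ENNReal.ofReal (1 - angle x.1 z.1 / Real.pi) ^ h := by
  rw [← stdGaussian_sgn_inner_eq (by simp; omega) (by simp) (by simp),
    ← gaussianMatrix_forall_col d h (measurableSet_sgn_inner_eq _ _)]
  rfl

/-- The kernel of the hyperplane arrangement with exponent `-d` is the Hilbert kernel
`angle(x, z)^(-d)`. -/
theorem kernel_hilbertArrangement (hd : 0 < d) (pH : PMF ℕ) (hpH : ∀ h, 0 < pH h)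
    (x z : Sphere d) :
    (hilbertArrangement d hd pH).kernel x z = (ENNReal.ofReal (angle x.1 z.1) ^ d)⁻¹ := by
  set t := 1 - angle x.1 z.1 / Real.pi with ht
  have ht0 : 0 ≤ t := sub_nonneg.2 (div_le_one_of_le₀ (angle_le_pi _ _) Real.pi_pos.le)
  have ht1 : t ≤ 1 := by
    rw [ht]; linarith [div_nonneg (angle_nonneg x.1 z.1) Real.pi_pos.le]
  have hm := measurableSet_sameSide x z
  have hα := measurable_hyperplaneWeight (d := d) (-(d : ℝ)) pH
  have hterm : ∀ h : ℕ, ∫⁻ W, ENNReal.ofReal (hyperplaneWeight d (-(d : ℝ)) pH W) *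
      (sameSide x z).indicator (fun _ => (1 : ℝ≥0∞)) W
        ∂(pH h • (gaussianMatrix d h).map (Sigma.mk h)) =
      ENNReal.ofReal (Real.pi ^ (-(d : ℝ))) *
        (ENNReal.ofReal ((-1) ^ h * binom (-(d : ℝ)) h) * ENNReal.ofReal t ^ h) := by
    intro h
    have hf : Measurable fun W => ENNReal.ofReal (hyperplaneWeight d (-(d : ℝ)) pH W) *
        (sameSide x z).indicator (fun _ => (1 : ℝ≥0∞)) W :=
      hα.ennreal_ofReal.mul (measurable_const.indicator hm)
    rw [lintegral_smul_measure, lintegral_map hf (measurable_sigma_mk d h)]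
    have hc : ∀ W : Matrix (Fin (d + 1)) (Fin h) ℝ, ENNReal.ofReal
        (hyperplaneWeight d (-(d : ℝ)) pH ⟨h, W⟩) *
        (sameSide x z).indicator (fun _ => (1 : ℝ≥0∞)) ⟨h, W⟩ =
        ENNReal.ofReal (Real.pi ^ (-(d : ℝ)) * (pH h).toReal⁻¹ *
          ((-1) ^ h * binom (-(d : ℝ)) h)) *
        (((fun W => ⟨h, W⟩) ⁻¹' sameSide x z).indicator 1 W) :=
      fun W => rfl
    simp_rw [hc]
    rw [lintegral_const_mul _ (measurable_one.indicator (measurable_sigma_mk d h hm)),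
      lintegral_indicator_one (measurable_sigma_mk d h hm), gaussianMatrix_sameSide hd,
      ENNReal.ofReal_mul (by positivity), ENNReal.ofReal_mul (by positivity),
      ENNReal.ofReal_inv_of_pos (ENNReal.toReal_pos (hpH h).ne' (pH.apply_ne_top h)),
      ENNReal.ofReal_toReal (pH.apply_ne_top h), smul_eq_mul]
    -- The weight compensates the probability of drawing `h` columns, so `pH` disappears from the
    -- kernel.
    have := ENNReal.mul_inv_cancel (hpH h).ne' (pH.apply_ne_top h)
    calc _ = (pH h * (pH h)⁻¹) * (ENNReal.ofReal (Real.pi ^ (-(d : ℝ))) *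
        (ENNReal.ofReal ((-1) ^ h * binom (-(d : ℝ)) h) * ENNReal.ofReal t ^ h)) := by ring
      _ = _ := by rw [this, one_mul]
  rw [kernel_hyperplaneArrangement, hyperplaneLaw, lintegral_sum_measure]
  simp_rw [hterm]
  rw [ENNReal.tsum_mul_left]
  obtain ⟨n, rfl⟩ : ∃ n, d = n + 1 := ⟨d - 1, by omega⟩
  simp_rw [neg_one_pow_mul_binom_neg]
  rw [tsum_choose_mul_pow n ht0 ht1, Real.rpow_neg Real.pi_pos.le, Real.rpow_natCast,
    ENNReal.ofReal_inv_of_pos (by positivity), ENNReal.ofReal_pow Real.pi_pos.le,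
    ← ENNReal.mul_inv (Or.inl (by positivity)) (Or.inl (by finiteness)), ← mul_pow,
    ← ENNReal.ofReal_mul Real.pi_pos.le]
  congr 3
  rw [ht]
  field_simp
  ring

end Kernel

/-! ### The sign of the ensemble -/

section Ensemble

variable {M : Type*}

/-- The total kernel weight at `x` of the training points with label `s`. -/
noncomputable def labelMass (K : M → M → ℝ≥0∞) {n : ℕ} (D : Fin n → M × ℤˣ) (x : M) (s : ℤˣ) :
    ℝ≥0∞ :=
  ∑ i, if (D i).2 = s then K x (D i).1 else 0

/-- Valid even for infinite masses: `⊥` absorbs in `EReal` addition, so both sides are `⊥` as soon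
as the label `-1` has infinite mass. -/
theorem ensemble_eq_sub (K : M → M → ℝ≥0∞) {n : ℕ} (D : Fin n → M × ℤˣ) (x : M) :
    ensemble K D x = (labelMass K D x 1 : EReal) - (labelMass K D x (-1) : EReal) := by
  unfold ensemble labelMass
  induction n with
  | zero => simp
  | succ n ih =>
    rw [Fin.sum_univ_castSucc, Fin.sum_univ_castSucc, Fin.sum_univ_castSucc,
      ih fun i => D i.castSucc]
    set A := ∑ i : Fin n, if (D i.castSucc).2 = 1 then K x (D i.castSucc).1 else 0
    set B := ∑ i : Fin n, if (D i.castSucc).2 = -1 then K x (D i.castSucc).1 else 0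
    set k := K x (D (Fin.last n)).1
    rcases Int.units_eq_one_or (D (Fin.last n)).2 with h | h
    · have h' : (D (Fin.last n)).2 ≠ -1 := by rw [h]; decide
      rw [if_pos h, if_neg h', h, add_zero, EReal.coe_ennreal_add, sub_eq_add_neg, sub_eq_add_neg]
      simp only [Units.val_one, Int.cast_one, EReal.coe_one, one_mul]
      rw [add_right_comm]
    · have h' : (D (Fin.last n)).2 ≠ 1 := by rw [h]; decide
      rw [if_pos h, if_neg h', h, add_zero, EReal.coe_ennreal_add, sub_eq_add_neg, sub_eq_add_neg,
        EReal.neg_add (Or.inl (EReal.coe_ennreal_ne_bot _)) (Or.inr (EReal.coe_ennreal_ne_bot _)),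
        sub_eq_add_neg, add_assoc]
      simp

/-- The finiteness clause records the convention `⊤ - ⊤ = ⊥`, which gives the sign `-1`. -/
theorem sgn_ensemble_eq_one_iff (K : M → M → ℝ≥0∞) {n : ℕ} (D : Fin n → M × ℤˣ) (x : M) :
    sgn (ensemble K D x) = 1 ↔
      labelMass K D x (-1) ≠ ⊤ ∧ labelMass K D x (-1) ≤ labelMass K D x 1 := by
  rw [ensemble_eq_sub]
  generalize labelMass K D x 1 = A
  generalize labelMass K D x (-1) = B
  have h1 : sgn ((A : EReal) - B) = 1 ↔ 0 ≤ (A : EReal) - B := by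
    unfold sgn
    split_ifs with h <;> simp [h]
  rw [h1]
  by_cases hB : B = ⊤
  · simp [hB]
  · have hB' : (B : EReal) ≠ ⊤ := by simpa using hB
    rw [EReal.sub_nonneg (Or.inr hB') (Or.inr (EReal.coe_ennreal_ne_bot _))]
    simp [hB]

theorem sgn_ensemble_eq_of_lt (K : M → M → ℝ≥0∞) {n : ℕ} (D : Fin n → M × ℤˣ) (x : M) {s : ℤˣ}
    (h : labelMass K D x (-s) < labelMass K D x s) : sgn (ensemble K D x) = s := by
  rcases Int.units_eq_one_or s with rfl | rfl
  · exact (sgn_ensemble_eq_one_iff K D x).2 ⟨h.ne_top, h.le⟩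
  · rw [neg_neg] at h
    refine (Int.units_eq_one_or _).resolve_left fun hc => ?_
    exact h.not_ge ((sgn_ensemble_eq_one_iff K D x).1 hc).2

/-- The mass of the correct label is infinite because of the point itself; an infinite term of the
other label would be the same point with a contradictory label. -/
theorem sgn_ensemble_interpolates (K : M → M → ℝ≥0∞) (hK : ∀ x z, K x z = ⊤ ↔ x = z) {n : ℕ}
    (D : Fin n → M × ℤˣ) (hD : ∀ i j, (D i).1 = (D j).1 → (D i).2 = (D j).2) (i : Fin n) :
    sgn (ensemble K D (D i).1) = (D i).2 := by
  refine sgn_ensemble_eq_of_lt K D _ ?_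
  have h1 : labelMass K D (D i).1 (D i).2 = ⊤ :=
    ENNReal.sum_eq_top.2 ⟨i, Finset.mem_univ i, by rw [if_pos rfl, hK]⟩
  rw [h1, lt_top_iff_ne_top]
  refine ENNReal.sum_ne_top.2 fun j _ => ?_
  split_ifs with h
  · rw [Ne, hK]
    intro hij
    rw [hD i j hij] at h
    revert h
    rcases Int.units_eq_one_or (D j).2 with h' | h' <;> rw [h'] <;> decide
  · exact ENNReal.zero_ne_top

theorem ensemble_eq_coe (K : M → M → ℝ≥0∞) {n : ℕ} (D : Fin n → M × ℤˣ) (x : M)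
    (h : ∀ i, K x (D i).1 ≠ ⊤) :
    ensemble K D x = ((∑ i, (((D i).2 : ℤ) : ℝ) * (K x (D i).1).toReal : ℝ) : EReal) := by
  unfold ensemble
  refine Eq.trans ?_
    (map_sum (⟨⟨Real.toEReal, EReal.coe_zero⟩, EReal.coe_add⟩ : ℝ →+ EReal) _ _).symm
  refine Finset.sum_congr rfl fun i _ => ?_
  change _ = (((((D i).2 : ℤ) : ℝ) * (K x (D i).1).toReal : ℝ) : EReal)
  rw [EReal.coe_mul, EReal.coe_ennreal_toReal (h i)]

end Ensemble

/-! ### Singularity of the kernel and the ensemble as an expectation -/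

section HilbertEnsemble

open InnerProductGeometry

variable {d : ℕ}

theorem kernel_hilbertArrangement_eq_top_iff (hd : 0 < d) (pH : PMF ℕ) (hpH : ∀ h, 0 < pH h)
    (x z : Sphere d) : (hilbertArrangement d hd pH).kernel x z = ⊤ ↔ x = z := by
  rw [kernel_hilbertArrangement hd pH hpH, ENNReal.inv_eq_top, pow_eq_zero_iff hd.ne',
    ENNReal.ofReal_eq_zero, (angle_nonneg _ _).ge_iff_eq', angle_eq_zero_iff, Subtype.ext_iff]
  have hx : ‖x.1‖ = 1 := by simp
  have hz : ‖z.1‖ = 1 := by simp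
  constructor
  · rintro ⟨_, r, hr, h⟩
    rw [h, norm_smul, hx, mul_one, Real.norm_of_nonneg hr.le] at hz
    rw [h, hz, one_smul]
  · exact fun h => ⟨fun h0 => by rw [h0] at hx; simp at hx, 1, one_pos, by rw [h, one_smul]⟩

/-- The integrand is nonnegative, so a finite kernel value is the same as integrability. -/
theorem integrable_hyperplaneWeight_mul_indicator {q : ℝ} (hq : q < 0) (pH : PMF ℕ)
    {x z : Sphere d} (h : (hyperplaneArrangement d q hq pH).kernel x z ≠ ⊤) :
    Integrable (fun W => hyperplaneWeight d q pH W * (sameSide x z).indicator (fun _ => (1 : ℝ)) W)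
      (hyperplaneLaw d pH) ∧
    ∫ W, hyperplaneWeight d q pH W * (sameSide x z).indicator (fun _ => (1 : ℝ)) W
      ∂(hyperplaneLaw d pH) = ((hyperplaneArrangement d q hq pH).kernel x z).toReal := by
  have hw : ∀ W, 0 ≤ hyperplaneWeight d q pH W := (hyperplaneArrangement d q hq pH).α_nonneg
  have hnn : ∀ W, 0 ≤ hyperplaneWeight d q pH W * (sameSide x z).indicator (fun _ => (1 : ℝ)) W :=
    fun W => mul_nonneg (hw W) (Set.indicator_nonneg (fun _ _ => zero_le_one) W)
  have hm : AEStronglyMeasurable (fun W => hyperplaneWeight d q pH W *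
      (sameSide x z).indicator (fun _ => (1 : ℝ)) W) (hyperplaneLaw d pH) :=
    ((measurable_hyperplaneWeight q pH).mul
      (measurable_const.indicator (measurableSet_sameSide x z))).aestronglyMeasurable
  have he : ∫⁻ W, ENNReal.ofReal (hyperplaneWeight d q pH W *
      (sameSide x z).indicator (fun _ => (1 : ℝ)) W) ∂(hyperplaneLaw d pH) =
      (hyperplaneArrangement d q hq pH).kernel x z := by
    rw [kernel_hyperplaneArrangement]
    refine lintegral_congr fun W => ?_
    rw [ENNReal.ofReal_mul (hw W)]
    congr 1
    by_cases hW : W ∈ sameSide x z <;> simp [hW]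
  constructor
  · rw [← lintegral_ofReal_ne_top_iff_integrable hm (Eventually.of_forall hnn), he]
    exact h
  · rw [integral_eq_lintegral_of_nonneg_ae (Eventually.of_forall hnn) hm, he]

theorem ensemble_eq_integral_histogram {q : ℝ} (hq : q < 0) (pH : PMF ℕ) {n : ℕ}
    (D : Fin n → Sphere d × ℤˣ) (x : Sphere d)
    (h : ∀ i, (hyperplaneArrangement d q hq pH).kernel x (D i).1 ≠ ⊤) :
    Integrable (fun θ => (hyperplaneArrangement d q hq pH).α θ *
      histogram D ((hyperplaneArrangement d q hq pH).part θ) x)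
        (hyperplaneArrangement d q hq pH).law ∧
    ensemble (hyperplaneArrangement d q hq pH).kernel D x =
      ((∫ θ, (hyperplaneArrangement d q hq pH).α θ *
        histogram D ((hyperplaneArrangement d q hq pH).part θ) x
          ∂(hyperplaneArrangement d q hq pH).law : ℝ) : EReal) := by
  have hfun : (fun W => (hyperplaneArrangement d q hq pH).α W *
      histogram D ((hyperplaneArrangement d q hq pH).part W) x) =
      fun W => ∑ i, (((D i).2 : ℤ) : ℝ) * (hyperplaneWeight d q pH W *
        (sameSide x (D i).1).indicator (fun _ => (1 : ℝ)) W) := by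
    funext W
    change hyperplaneWeight d q pH W * histogram D ((hyperplaneArrangement d q hq pH).part W) x = _
    rw [histogram, Finset.mul_sum]
    refine Finset.sum_congr rfl fun i _ => ?_
    rw [indicator_cell_hyperplaneArrangement q hq pH 1 x (D i).1 W]
    ring
  rw [hfun, ensemble_eq_coe _ D x h]
  have hint := fun i => integrable_hyperplaneWeight_mul_indicator hq pH (h i)
  refine ⟨integrable_finsetSum _ fun i _ => (hint i).1.const_mul _, ?_⟩
  congr 1
  refine Eq.trans ?_ (integral_finsetSum _ fun i _ => (hint i).1.const_mul _).symm
  refine Finset.sum_congr rfl fun i _ => ?_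
  rw [integral_const_mul, (hint i).2]

end HilbertEnsemble

/-! ### Volumes of balls of the sphere -/

section SphereVolume

open Metric Topology
open scoped Pointwise

variable {d : ℕ}

theorem exists_orthonormalBasis_zero_eq (x : Sphere d) :
    ∃ b : OrthonormalBasis (Fin (d + 1)) ℝ (EuclideanSpace ℝ (Fin (d + 1))), b 0 = x.1 := by
  obtain ⟨b, hb⟩ := Orthonormal.exists_orthonormalBasis_extension_of_card_eq (𝕜 := ℝ)
    (E := EuclideanSpace ℝ (Fin (d + 1))) (ι := Fin (d + 1)) (by simp) (v := fun _ => x.1)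
    (s := {0}) ⟨fun i => by simp, fun i j hij => absurd (Subsingleton.elim i j) hij⟩
  exact ⟨b, hb 0 rfl⟩

theorem volume_coordinate_box {ι : Type*} [Fintype ι]
    (b : OrthonormalBasis ι ℝ (EuclideanSpace ℝ ι)) (I : ι → Set ℝ)
    (hI : ∀ i, MeasurableSet (I i)) :
    volume {y : EuclideanSpace ℝ ι | ∀ i, ⟪b i, y⟫ ∈ I i} = ∏ i, volume (I i) := by
  have h1 := (PiLp.volume_preserving_ofLp ι).comp b.measurePreserving_repr
  rw [← volume_pi_pi, ← h1.measure_preimage (MeasurableSet.univ_pi hI).nullMeasurableSet]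
  congr 1
  ext y
  simp [b.repr_apply_apply]

/-- In orthonormal coordinates with first axis `x`, the cone over the ball lies in a box of side `2`
along `x` and `2 * r` in the other `d` directions. -/
theorem sphereVolume_closedBall_le (d : ℕ) : ∃ C : ℝ, 0 < C ∧ ∀ (x : Sphere d) (r : ℝ), 0 ≤ r →
    sphereVolume d (closedBall x r) ≤ ENNReal.ofReal (C * r ^ d) := by
  refine ⟨(d + 1) * (2 * 2 ^ d), by positivity, fun x r hr => ?_⟩
  obtain ⟨b, hb⟩ := exists_orthonormalBasis_zero_eq x
  have hsub : Set.Ioo (0 : ℝ) 1 • ((↑) '' closedBall x r : Set (EuclideanSpace ℝ (Fin (d + 1)))) ⊆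
      {y | ∀ i, ⟪b i, y⟫ ∈ (Fin.cons (Set.Icc (-1) 1) fun _ => Set.Icc (-r) r :
        Fin (d + 1) → Set ℝ) i} := by
    rintro _ ⟨t, ht, _, ⟨w, hw, rfl⟩, rfl⟩
    have hwn : ‖w.1‖ = 1 := by simp
    have hwx : ‖w.1 - x.1‖ ≤ r := by
      rw [← dist_eq_norm]; exact hw
    intro i
    refine Fin.cases ?_ (fun i => ?_) i
    · simp only [Fin.cons_zero, Set.mem_Icc, ← abs_le, inner_smul_right]
      rw [abs_mul, abs_of_pos ht.1]
      have h1 : |⟪b 0, w.1⟫| ≤ 1 := by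
        simpa [hwn] using abs_real_inner_le_norm (b 0) w.1
      nlinarith [ht.1, ht.2, abs_nonneg ⟪b 0, w.1⟫]
    · simp only [Fin.cons_succ, Set.mem_Icc, ← abs_le, inner_smul_right]
      rw [abs_mul, abs_of_pos ht.1]
      have h0 : ⟪b i.succ, x.1⟫ = 0 := by
        rw [← hb]; exact b.orthonormal.2 (Fin.succ_ne_zero i)
      have h1 : |⟪b i.succ, w.1⟫| ≤ r := by
        have h2 := abs_real_inner_le_norm (b i.succ) (w.1 - x.1)
        rw [inner_sub_right, h0, sub_zero, b.orthonormal.1, one_mul] at h2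
        exact h2.trans hwx
      nlinarith [ht.1, ht.2, abs_nonneg ⟪b i.succ, w.1⟫]
  have hvol := volume_coordinate_box b (Fin.cons (Set.Icc (-1) 1) fun _ => Set.Icc (-r) r)
    (fun i => Fin.cases measurableSet_Icc (fun _ => measurableSet_Icc) i)
  rw [Fin.prod_univ_succ] at hvol
  simp only [Fin.cons_zero, Fin.cons_succ, Real.volume_Icc, Finset.prod_const, Finset.card_univ,
    Fintype.card_fin] at hvol
  rw [sphereVolume, Measure.toSphere_apply' _ isClosed_closedBall.measurableSet]
  refine (mul_le_mul_right (measure_mono hsub) _).trans ?_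
  rw [hvol, ← ENNReal.ofReal_pow (by linarith), ← ENNReal.ofReal_mul (by norm_num),
    finrank_euclideanSpace_fin, ← ENNReal.ofReal_natCast, ← ENNReal.ofReal_mul (by positivity)]
  refine ENNReal.ofReal_le_ofReal (le_of_eq ?_)
  push_cast
  rw [show r - -r = 2 * r by ring, mul_pow]
  ring

/-- Conversely, the cone contains a thin box around a segment of the axis `x`, of length `1 / 4` and
with tangential sides proportional to `r`. -/
theorem le_sphereVolume_closedBall (d : ℕ) : ∃ c : ℝ, 0 < c ∧ ∀ (x : Sphere d) (r : ℝ), 0 ≤ r →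
    r ≤ 2 → ENNReal.ofReal (c * r ^ d) ≤ sphereVolume d (closedBall x r) := by
  refine ⟨(d + 1) * (1 / 4 * (1 / (4 * (d + 1))) ^ d), by positivity, fun x r hr hr2 => ?_⟩
  obtain ⟨b, hb⟩ := exists_orthonormalBasis_zero_eq x
  -- Chosen so that the `d` tangential components together have norm at most `r / 8`; as `r ≤ 2`,
  -- the box then stays inside the unit ball.
  set ρ := r / (8 * (d + 1)) with hρ
  have hρ0 : 0 ≤ ρ := by positivity
  have hdρ : d * ρ ≤ r / 8 := by
    rw [hρ, mul_div_assoc', div_le_div_iff₀ (by positivity) (by norm_num)]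
    nlinarith
  have hsub : {y | ∀ i, ⟪b i, y⟫ ∈ (Fin.cons (Set.Icc (1 / 4) (1 / 2)) fun _ => Set.Icc (-ρ) ρ :
        Fin (d + 1) → Set ℝ) i} ⊆
      Set.Ioo (0 : ℝ) 1 • ((↑) '' closedBall x r : Set (EuclideanSpace ℝ (Fin (d + 1)))) := by
    intro y hy
    have hy0 := hy 0
    simp only [Fin.cons_zero] at hy0
    have hys : ∀ i : Fin d, |⟪b i.succ, y⟫| ≤ ρ := fun i => by
      have := hy i.succ
      simp only [Fin.cons_succ] at this
      exact abs_le.2 this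
    set s := ⟪b 0, y⟫ with hs
    have hw : ‖y - s • x.1‖ ≤ r / 8 := by
      have h1 : y - s • x.1 = ∑ i : Fin d, ⟪b i.succ, y⟫ • b i.succ := by
        conv_lhs => rw [← b.sum_repr' y, Fin.sum_univ_succ, hb]
        rw [hs, hb]
        abel
      rw [h1]
      refine (norm_sum_le _ _).trans ?_
      calc ∑ i : Fin d, ‖⟪b i.succ, y⟫ • b i.succ‖ ≤ ∑ _i : Fin d, ρ :=
            Finset.sum_le_sum fun i _ => by
              rw [norm_smul, b.orthonormal.1, mul_one]; exact hys i
        _ = d * ρ := by simp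
        _ ≤ r / 8 := hdρ
    have hxn : ‖x.1‖ = 1 := by simp
    have hsn : ‖s • x.1‖ = s := by
      rw [norm_smul, hxn, mul_one, Real.norm_of_nonneg (by linarith [hy0.1])]
    have hdiff : |‖y‖ - s| ≤ r / 8 := by
      rw [← hsn]; exact (abs_norm_sub_norm_le _ _).trans hw
    have hsy : s ≤ ‖y‖ := by
      have := real_inner_le_norm (b 0) y
      rwa [b.orthonormal.1, one_mul] at this
    have hypos : 0 < ‖y‖ := by linarith [hy0.1]
    have hylt : ‖y‖ < 1 := by
      have := (abs_le.1 hdiff).2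
      linarith [hy0.2]
    refine ⟨‖y‖, ⟨hypos, hylt⟩, ‖y‖⁻¹ • y, ⟨⟨‖y‖⁻¹ • y, ?_⟩, ?_, rfl⟩, ?_⟩
    · simp [norm_smul, hypos.ne']
    · rw [mem_closedBall, Subtype.dist_eq, dist_eq_norm]
      change ‖‖y‖⁻¹ • y - x.1‖ ≤ r
      -- The vector in parentheses has norm at most `r / 4`, and `‖y‖ ≥ 1 / 4` bounds the quotient
      -- by `r`.
      have h1 : ‖y‖⁻¹ • y - x.1 = ‖y‖⁻¹ • (y - s • x.1 + (s - ‖y‖) • x.1) := by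
        rw [show y - s • x.1 + (s - ‖y‖) • x.1 = y - ‖y‖ • x.1 by rw [sub_smul]; abel, smul_sub,
          smul_smul, inv_mul_cancel₀ hypos.ne', one_smul]
      have h2 : ‖y - s • x.1 + (s - ‖y‖) • x.1‖ ≤ r / 4 := by
        refine (norm_add_le _ _).trans ?_
        rw [norm_smul, hxn, mul_one, Real.norm_eq_abs, abs_sub_comm]
        linarith
      rw [h1, norm_smul, norm_inv, norm_norm, inv_mul_le_iff₀ hypos]
      nlinarith [hy0.1]
    · simp [smul_smul, hypos.ne']
  have hvol := volume_coordinate_box b (Fin.cons (Set.Icc (1 / 4) (1 / 2)) fun _ => Set.Icc (-ρ) ρ)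
    (fun i => Fin.cases measurableSet_Icc (fun _ => measurableSet_Icc) i)
  rw [Fin.prod_univ_succ] at hvol
  simp only [Fin.cons_zero, Fin.cons_succ, Real.volume_Icc, Finset.prod_const, Finset.card_univ,
    Fintype.card_fin] at hvol
  rw [sphereVolume, Measure.toSphere_apply' _ isClosed_closedBall.measurableSet]
  refine le_trans ?_ (mul_le_mul_right (measure_mono hsub) _)
  rw [hvol, ← ENNReal.ofReal_pow (by linarith), ← ENNReal.ofReal_mul (by norm_num),
    finrank_euclideanSpace_fin, ← ENNReal.ofReal_natCast, ← ENNReal.ofReal_mul (by positivity)]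
  refine ENNReal.ofReal_le_ofReal (le_of_eq ?_)
  push_cast
  rw [show ρ - -ρ = 1 / (4 * (d + 1)) * r by rw [hρ]; field_simp; ring, mul_pow]
  ring

/-- Both volume bounds have order `r ^ d`. Doubling makes Lebesgue differentiation along balls
available. -/
instance isUnifLocDoublingMeasure_sphereVolume (d : ℕ) :
    IsUnifLocDoublingMeasure (sphereVolume d) := by
  obtain ⟨C, hC, hup⟩ := sphereVolume_closedBall_le d
  obtain ⟨c, hc, hlow⟩ := le_sphereVolume_closedBall d
  refine ⟨⟨(C * 2 ^ d / c).toNNReal, ?_⟩⟩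
  have hmem : Set.Ioo (0 : ℝ) 2 ∈ 𝓝[>] (0 : ℝ) := Ioo_mem_nhdsGT two_pos
  filter_upwards [hmem] with ε hε x
  have hε0 : 0 ≤ ε := hε.1.le
  refine (hup x (2 * ε) (by linarith)).trans ?_
  refine le_trans ?_ (mul_le_mul_right (hlow x ε hε0 hε.2.le) _)
  rw [ENNReal.ofNNReal_toNNReal, ← ENNReal.ofReal_mul (by positivity)]
  refine ENNReal.ofReal_le_ofReal (le_of_eq ?_)
  rw [mul_pow]
  field_simp

instance isFiniteMeasure_sphereVolume (d : ℕ) : IsFiniteMeasure (sphereVolume d) :=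
  inferInstanceAs (IsFiniteMeasure (volume : Measure (EuclideanSpace ℝ (Fin (d + 1)))).toSphere)

theorem ae_tendsto_closedBall_div (ρ : Measure (Sphere d)) [IsFiniteMeasure ρ] :
    ∀ᵐ x ∂(sphereVolume d), Tendsto
      (fun r => ρ (closedBall x r) / sphereVolume d (closedBall x r)) (𝓝[>] 0)
      (𝓝 (ρ.rnDeriv (sphereVolume d) x)) := by
  filter_upwards [(IsUnifLocDoublingMeasure.vitaliFamily (sphereVolume d) 1).ae_tendsto_rnDeriv ρ]
    with x hx
  refine hx.comp (IsUnifLocDoublingMeasure.tendsto_closedBall_filterAt _ (fun _ => x) id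
    tendsto_id ?_)
  filter_upwards [self_mem_nhdsWithin] with r hr
  simpa using le_of_lt hr

theorem sphereVolume_singleton (hd : 0 < d) (x : Sphere d) : sphereVolume d {x} = 0 := by
  obtain ⟨C, hC, hup⟩ := sphereVolume_closedBall_le d
  have := hup x 0 le_rfl
  rwa [zero_pow hd.ne', mul_zero, ENNReal.ofReal_zero, closedBall_zero, nonpos_iff_eq_zero] at this

end SphereVolume

/-! ### Competing sums of heavy-tailed weights -/

section HeavyTails

open Set Topology

variable {T : Type*} {w : T → ℝ≥0∞} {M : ℝ}

/-- The truncation of a weight function at height `M`. -/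
noncomputable def trunc (w : T → ℝ≥0∞) (M : ℝ) (p : T) : ℝ := (min (w p) (ENNReal.ofReal M)).toReal

theorem trunc_nonneg (w : T → ℝ≥0∞) (M : ℝ) (p : T) : 0 ≤ trunc w M p := ENNReal.toReal_nonneg

theorem trunc_le (w : T → ℝ≥0∞) (hM : 0 ≤ M) (p : T) : trunc w M p ≤ M :=
  ENNReal.toReal_le_of_le_ofReal hM (min_le_right _ _)

theorem ofReal_trunc (w : T → ℝ≥0∞) (M : ℝ) (p : T) :
    ENNReal.ofReal (trunc w M p) = min (w p) (ENNReal.ofReal M) :=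
  ENNReal.ofReal_toReal (ne_top_of_le_ne_top ENNReal.ofReal_ne_top (min_le_right _ _))

theorem le_trunc_iff (w : T → ℝ≥0∞) {t : ℝ} (htM : t ≤ M) (p : T) :
    t ≤ trunc w M p ↔ ENNReal.ofReal t ≤ w p := by
  rw [← ENNReal.ofReal_le_ofReal_iff (trunc_nonneg w M p), ofReal_trunc, le_min_iff]
  exact and_iff_left (ENNReal.ofReal_le_ofReal htM)

/-- The truncated weight function with the sign of membership in `A`. -/
noncomputable def signedTrunc (w : T → ℝ≥0∞) (M : ℝ) (A : Set T) (p : T) : ℝ :=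
  A.indicator (trunc w M) p - Aᶜ.indicator (trunc w M) p

theorem signedTrunc_sq (w : T → ℝ≥0∞) (M : ℝ) (A : Set T) (p : T) :
    signedTrunc w M A p ^ 2 = trunc w M p ^ 2 := by
  by_cases hp : p ∈ A <;> simp [signedTrunc, hp]

variable [MeasurableSpace T]

theorem measurable_trunc (hw : Measurable w) (M : ℝ) : Measurable (trunc w M) :=
  (hw.min measurable_const).ennreal_toReal

theorem measure_le_trunc (w : T → ℝ≥0∞) {t : ℝ} (ht : 0 < t) (hM : 0 ≤ M) (ν : Measure T) :
    ν {p | t ≤ trunc w M p} =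
      (Ioc 0 M).indicator (fun t => ν {p | ENNReal.ofReal t ≤ w p}) t := by
  by_cases htM : t ≤ M
  · rw [indicator_of_mem (show t ∈ Ioc 0 M from ⟨ht, htM⟩)]
    simp_rw [le_trunc_iff w htM]
  · rw [indicator_of_notMem (fun h => htM h.2)]
    have : {p | t ≤ trunc w M p} = ∅ := by
      ext p
      simp only [mem_ofPred_eq, mem_empty_iff_false, iff_false]
      exact fun h => htM (h.trans (trunc_le w hM p))
    rw [this, measure_empty]

/-- Layer-cake formula; truncation cuts the tail off at `M`. -/
theorem lintegral_trunc (hw : Measurable w) (hM : 0 ≤ M) (ν : Measure T) :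
    ∫⁻ p, ENNReal.ofReal (trunc w M p) ∂ν =
      ∫⁻ t in Ioc 0 M, ν {p | ENNReal.ofReal t ≤ w p} := by
  rw [lintegral_eq_lintegral_meas_le ν (Eventually.of_forall (trunc_nonneg w M))
    (measurable_trunc hw M).aemeasurable,
    setLIntegral_congr_fun measurableSet_Ioi (fun t ht => measure_le_trunc w ht hM ν),
    setLIntegral_indicator measurableSet_Ioc, inter_eq_left.2 Ioc_subset_Ioi_self]

theorem setLIntegral_const_div {c t₀ : ℝ} (hc : 0 ≤ c) (ht₀ : 0 < t₀) (hM : t₀ ≤ M) :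
    ∫⁻ t in Ioc t₀ M, ENNReal.ofReal (c / t) = ENNReal.ofReal (c * Real.log (M / t₀)) := by
  have hint : IntegrableOn (fun t : ℝ => c / t) (Ioc t₀ M) := by
    have : ContinuousOn (fun t : ℝ => c / t) (Icc t₀ M) :=
      continuousOn_const.div continuousOn_id fun t ht => (ht₀.trans_le ht.1).ne'
    exact this.integrableOn_Icc.mono_set Ioc_subset_Icc_self
  rw [← ofReal_integral_eq_lintegral_ofReal hint, ← intervalIntegral.integral_of_le hM]
  · simp_rw [div_eq_mul_inv c]
    rw [intervalIntegral.integral_const_mul, integral_inv_of_pos ht₀ (ht₀.trans_le hM)]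
  · filter_upwards [ae_restrict_mem measurableSet_Ioc] with t ht
    exact div_nonneg hc (ht₀.trans ht.1).le

theorem measurable_tail (ν : Measure T) : Measurable fun t : ℝ => ν {p | ENNReal.ofReal t ≤ w p} :=
  Antitone.measurable fun _ _ h => measure_mono fun _ hp =>
    (ENNReal.ofReal_le_ofReal h).trans hp

/-- If the tails of `w` under `ν₁` exceed those under `ν₂` by `c / t`, then the truncated means
differ by a logarithm of the truncation level. -/
theorem integral_trunc_drift (hw : Measurable w) {ν₁ ν₂ : Measure T} [IsFiniteMeasure ν₁]
    [IsFiniteMeasure ν₂] (hν₂ : ν₂ univ ≤ 1) {c t₀ : ℝ} (hc : 0 ≤ c) (ht₀ : 0 < t₀) (hM : t₀ ≤ M)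
    (h : ∀ t, t₀ ≤ t → ν₂ {p | ENNReal.ofReal t ≤ w p} + ENNReal.ofReal (c / t) ≤
      ν₁ {p | ENNReal.ofReal t ≤ w p}) :
    c * Real.log (M / t₀) - t₀ ≤ ∫ p, trunc w M p ∂ν₁ - ∫ p, trunc w M p ∂ν₂ := by
  have hM0 : 0 ≤ M := ht₀.le.trans hM
  have hint : ∀ ν : Measure T, IsFiniteMeasure ν → Integrable (trunc w M) ν := fun ν _ =>
    Integrable.of_bound (measurable_trunc hw M).aestronglyMeasurable M
      (Eventually.of_forall fun p => by
        rw [Real.norm_of_nonneg (trunc_nonneg w M p)]; exact trunc_le w hM0 p)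
  have hof : ∀ ν : Measure T, IsFiniteMeasure ν → ∫⁻ p, ENNReal.ofReal (trunc w M p) ∂ν =
      ENNReal.ofReal (∫ p, trunc w M p ∂ν) := fun ν hν =>
    (ofReal_integral_eq_lintegral_ofReal (hint ν hν) (Eventually.of_forall (trunc_nonneg w M))).symm
  -- Below `t₀` nothing is known, but the tail of `ν₂` is at most one there, which costs `t₀`; above
  -- it the excess `c / t` integrates to the logarithm.
  have h1 : ∫⁻ p, ENNReal.ofReal (trunc w M p) ∂ν₂ + ENNReal.ofReal (c * Real.log (M / t₀)) ≤
      ∫⁻ p, ENNReal.ofReal (trunc w M p) ∂ν₁ + ENNReal.ofReal t₀ := by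
    rw [lintegral_trunc hw hM0, lintegral_trunc hw hM0, ← setLIntegral_const_div hc ht₀ hM,
      ← Ioc_union_Ioc_eq_Ioc ht₀.le hM,
      lintegral_union measurableSet_Ioc (Ioc_disjoint_Ioc_of_le le_rfl),
      lintegral_union measurableSet_Ioc (Ioc_disjoint_Ioc_of_le le_rfl), add_assoc,
      ← lintegral_add_left (measurable_tail ν₂), add_comm _ (ENNReal.ofReal t₀)]
    refine add_le_add ?_ ?_
    · calc ∫⁻ t in Ioc 0 t₀, ν₂ {p | ENNReal.ofReal t ≤ w p}
          ≤ ∫⁻ _t in Ioc 0 t₀, 1 := lintegral_mono fun t => (measure_mono (subset_univ _)).trans hν₂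
        _ = ENNReal.ofReal t₀ := by simp
    · exact (setLIntegral_mono (measurable_tail ν₁) fun t ht => h t ht.1.le).trans le_add_self
  have hnn : ∀ ν : Measure T, 0 ≤ ∫ p, trunc w M p ∂ν := fun ν => integral_nonneg (trunc_nonneg w M)
  have hlog : 0 ≤ c * Real.log (M / t₀) :=
    mul_nonneg hc (Real.log_nonneg ((one_le_div ht₀).2 hM))
  rw [hof ν₁ inferInstance, hof ν₂ inferInstance, ← ENNReal.ofReal_add (hnn _) hlog,
    ← ENNReal.ofReal_add (hnn _) ht₀.le,
    ENNReal.ofReal_le_ofReal_iff (add_nonneg (hnn _) ht₀.le)] at h1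
  linarith

/-- The second moment is `2 ∫ t ν(w ≥ t) dt` over `(0, M]`, and the tail bound makes `t ν(w ≥ t)` at
most `C`. -/
theorem integral_trunc_sq_le (hw : Measurable w) {ν : Measure T} [IsFiniteMeasure ν] {C : ℝ}
    (hC : 0 ≤ C) (hM : 0 ≤ M)
    (h : ∀ t, 0 < t → ν {p | ENNReal.ofReal t ≤ w p} ≤ ENNReal.ofReal (C / t)) :
    ∫ p, trunc w M p ^ 2 ∂ν ≤ 2 * (C * M) := by
  rw [integral_eq_lintegral_of_nonneg_ae (Eventually.of_forall fun p => sq_nonneg _)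
    ((measurable_trunc hw M).pow_const 2).aestronglyMeasurable]
  refine ENNReal.toReal_le_of_le_ofReal (by positivity) ?_
  have h1 := lintegral_rpow_eq_lintegral_meas_le_mul ν (Eventually.of_forall (trunc_nonneg w M))
    (measurable_trunc hw M).aemeasurable (p := 2) two_pos
  simp only [Real.rpow_two] at h1
  rw [h1, ENNReal.ofReal_mul two_pos.le]
  refine mul_le_mul_right ?_ _
  calc ∫⁻ t in Ioi (0 : ℝ), ν {p | t ≤ trunc w M p} * ENNReal.ofReal (t ^ ((2 : ℝ) - 1))
      ≤ ∫⁻ t in Ioi (0 : ℝ), (Ioc 0 M).indicator (fun _ => ENNReal.ofReal C) t := by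
        refine setLIntegral_mono (measurable_const.indicator measurableSet_Ioc) fun t ht => ?_
        have ht' : (0 : ℝ) < t := ht
        rw [measure_le_trunc w ht hM]
        by_cases hmem : t ∈ Ioc 0 M
        · rw [indicator_of_mem hmem, indicator_of_mem hmem, show (2 : ℝ) - 1 = 1 by norm_num,
            Real.rpow_one]
          refine (mul_le_mul_left (h t ht) _).trans ?_
          rw [← ENNReal.ofReal_mul (by positivity), div_mul_cancel₀ _ ht'.ne']
        · rw [indicator_of_notMem hmem, indicator_of_notMem hmem, zero_mul]
    _ = ENNReal.ofReal (C * M) := by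
        rw [setLIntegral_indicator measurableSet_Ioc, inter_eq_left.2 Ioc_subset_Ioi_self,
          setLIntegral_const, Real.volume_Ioc, sub_zero, ENNReal.ofReal_mul hC]

variable {Ω : Type*} [MeasurableSpace Ω] {P : Measure Ω} [IsProbabilityMeasure P]
  {μ : Measure T} [IsProbabilityMeasure μ] {Z : ℕ → Ω → T}

theorem measurable_signedTrunc (hw : Measurable w) (M : ℝ) {A : Set T} (hA : MeasurableSet A) :
    Measurable (signedTrunc w M A) :=
  ((measurable_trunc hw M).indicator hA).sub ((measurable_trunc hw M).indicator hA.compl)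

/-- Chebyshev's inequality for a sum of signed truncated weights. -/
theorem prob_sum_signedTrunc_nonpos_le (hw : Measurable w) {A : Set T} (hA : MeasurableSet A)
    (hZ : ∀ i, Measurable (Z i)) (hlaw : ∀ i, P.map (Z i) = μ) (hind : iIndepFun Z P)
    {C m : ℝ} (hC : 0 ≤ C) (hM : 0 ≤ M) (hm : 0 < m)
    (htail : ∀ t, 0 < t → μ {p | ENNReal.ofReal t ≤ w p} ≤ ENNReal.ofReal (C / t))
    (hmean : m ≤ ∫ p in A, trunc w M p ∂μ - ∫ p in Aᶜ, trunc w M p ∂μ) {n : ℕ} (hn : 0 < n) :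
    P {ω | ∑ i ∈ Finset.range n, signedTrunc w M A (Z i ω) ≤ 0} ≤
      ENNReal.ofReal (2 * C * M / (n * m ^ 2)) := by
  set ξ : T → ℝ := signedTrunc w M A with hξ
  have hξm : Measurable ξ := measurable_signedTrunc hw M hA
  have hξb : ∀ p, ‖ξ p‖ ≤ M := fun p => by
    rw [Real.norm_eq_abs, ← abs_of_nonneg hM, ← sq_le_sq, signedTrunc_sq]
    exact pow_le_pow_left₀ (trunc_nonneg w M p) (trunc_le w hM p) 2
  have hmem : ∀ i, MemLp (fun ω => ξ (Z i ω)) 2 P := fun i =>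
    MemLp.of_bound (hξm.comp (hZ i)).aestronglyMeasurable M (Eventually.of_forall fun ω => hξb _)
  have hmap : ∀ (g : T → ℝ) (i : ℕ), Measurable g → ∫ ω, g (Z i ω) ∂P = ∫ p, g p ∂μ :=
    fun g i hg => by
      rw [← hlaw i, integral_map (hZ i).aemeasurable hg.aestronglyMeasurable]
  have hint : Integrable (trunc w M) μ :=
    Integrable.of_bound (measurable_trunc hw M).aestronglyMeasurable M
      (Eventually.of_forall fun p => by
        rw [Real.norm_of_nonneg (trunc_nonneg w M p)]; exact trunc_le w hM p)
  have hmean' : m ≤ ∫ p, ξ p ∂μ := by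
    have : ∫ p, ξ p ∂μ = ∫ p in A, trunc w M p ∂μ - ∫ p in Aᶜ, trunc w M p ∂μ := by
      rw [hξ]
      simp only [signedTrunc]
      rw [integral_sub (hint.indicator hA) (hint.indicator hA.compl), integral_indicator hA,
        integral_indicator hA.compl]
    rwa [this]
  set S : Ω → ℝ := ∑ i ∈ Finset.range n, fun ω => ξ (Z i ω) with hS
  have hSapp : ∀ ω, S ω = ∑ i ∈ Finset.range n, ξ (Z i ω) := fun ω => by
    rw [hS, Finset.sum_apply]
  have hSmem : MemLp S 2 P := memLp_finsetSum' _ fun i _ => hmem i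
  have hSmean : ∫ ω, S ω ∂P = n * ∫ p, ξ p ∂μ := by
    simp_rw [hSapp]
    rw [integral_finsetSum _ fun i _ => (hmem i).integrable one_le_two]
    simp_rw [hmap ξ _ hξm]
    simp
  have hSvar : Var[S; P] ≤ n * (2 * (C * M)) := by
    rw [hS, IndepFun.variance_sum (fun i _ => hmem i)
      (fun i _ j _ hij => (hind.indepFun hij).comp hξm hξm)]
    calc ∑ i ∈ Finset.range n, Var[fun ω => ξ (Z i ω); P]
        ≤ ∑ _i ∈ Finset.range n, 2 * (C * M) := by
          refine Finset.sum_le_sum fun i _ => ?_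
          refine (variance_le_expectation_sq (hmem i).aestronglyMeasurable).trans ?_
          simp only [Pi.pow_apply]
          rw [hmap (fun p => ξ p ^ 2) i (hξm.pow_const 2)]
          simp_rw [hξ, signedTrunc_sq]
          exact integral_trunc_sq_le hw hC hM htail
      _ = n * (2 * (C * M)) := by simp
  have hn' : (0 : ℝ) < n := Nat.cast_pos.2 hn
  -- The sum has mean at least `n * m`, so being nonpositive is a deviation of at least that size.
  refine (measure_mono ?_).trans ((meas_ge_le_variance_div_sq hSmem (c := n * m)
    (by positivity)).trans (ENNReal.ofReal_le_ofReal ?_))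
  · intro ω hω
    have hω' : S ω ≤ 0 := by rw [hSapp]; exact hω
    have h1 : n * m ≤ n * ∫ p, ξ p ∂μ := mul_le_mul_of_nonneg_left hmean' hn'.le
    change n * m ≤ |S ω - ∫ ω, S ω ∂P|
    rw [hSmean, abs_sub_comm]
    exact le_trans (by linarith) (le_abs_self _)
  · calc Var[S; P] / (n * m) ^ 2 ≤ n * (2 * (C * M)) / (n * m) ^ 2 := by gcongr
      _ = 2 * C * M / (n * m ^ 2) := by field_simp

end HeavyTails

/-! ### Removing the truncation and letting the sample grow -/

section HeavyTailsLimit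

open Set Topology

variable {T : Type*} [MeasurableSpace T] {w : T → ℝ≥0∞} {Ω : Type*} [MeasurableSpace Ω]
  {P : Measure Ω} [IsProbabilityMeasure P] {μ : Measure T} [IsProbabilityMeasure μ] {Z : ℕ → Ω → T}

/-- Either some weight reaches `M`, which a union bound controls, or truncation changes nothing and
the signed truncated sum is nonpositive. -/
theorem prob_sum_indicator_le (hw : Measurable w) {A : Set T} (hA : MeasurableSet A)
    (hZ : ∀ i, Measurable (Z i)) (hlaw : ∀ i, P.map (Z i) = μ) (hind : iIndepFun Z P)
    {C m M : ℝ} (hC : 0 ≤ C) (hM : 0 < M) (hm : 0 < m)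
    (htail : ∀ t, 0 < t → μ {p | ENNReal.ofReal t ≤ w p} ≤ ENNReal.ofReal (C / t))
    (hmean : m ≤ ∫ p in A, trunc w M p ∂μ - ∫ p in Aᶜ, trunc w M p ∂μ) {n : ℕ} (hn : 0 < n) :
    P {ω | ∑ i ∈ Finset.range n, A.indicator w (Z i ω) ≤
        ∑ i ∈ Finset.range n, Aᶜ.indicator w (Z i ω)} ≤
      ENNReal.ofReal (2 * C * M / (n * m ^ 2) + n * (C / M)) := by
  have hsub : {ω | ∑ i ∈ Finset.range n, A.indicator w (Z i ω) ≤
        ∑ i ∈ Finset.range n, Aᶜ.indicator w (Z i ω)} ⊆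
      {ω | ∑ i ∈ Finset.range n, signedTrunc w M A (Z i ω) ≤ 0} ∪
        ⋃ i ∈ Finset.range n, Z i ⁻¹' {p | ENNReal.ofReal M ≤ w p} := by
    intro ω hω
    by_contra hcon
    rw [mem_union, not_or] at hcon
    obtain ⟨h1, h2⟩ := hcon
    have hlt : ∀ i ∈ Finset.range n, w (Z i ω) = ENNReal.ofReal (trunc w M (Z i ω)) := by
      intro i hi
      rw [ofReal_trunc, min_eq_left]
      by_contra! hc
      exact h2 (mem_biUnion hi (show ENNReal.ofReal M ≤ w (Z i ω) from hc.le))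
    have hsum : ∀ B : Set T, ∑ i ∈ Finset.range n, B.indicator w (Z i ω) =
        ENNReal.ofReal (∑ i ∈ Finset.range n, B.indicator (trunc w M) (Z i ω)) := by
      intro B
      rw [ENNReal.ofReal_sum_of_nonneg fun i _ =>
        indicator_nonneg (fun p _ => trunc_nonneg w M p) _]
      refine Finset.sum_congr rfl fun i hi => ?_
      by_cases hB : Z i ω ∈ B
      · rw [indicator_of_mem hB, indicator_of_mem hB, hlt i hi]
      · rw [indicator_of_notMem hB, indicator_of_notMem hB, ENNReal.ofReal_zero]
    have hω' : ∑ i ∈ Finset.range n, A.indicator w (Z i ω) ≤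
        ∑ i ∈ Finset.range n, Aᶜ.indicator w (Z i ω) := hω
    rw [hsum, hsum, ENNReal.ofReal_le_ofReal_iff (Finset.sum_nonneg fun i _ =>
        indicator_nonneg (fun p _ => trunc_nonneg w M p) _)] at hω'
    refine h1 ?_
    change ∑ i ∈ Finset.range n, signedTrunc w M A (Z i ω) ≤ 0
    simp only [signedTrunc, Finset.sum_sub_distrib]
    linarith
  refine (measure_mono hsub).trans ((measure_union_le _ _).trans ?_)
  rw [ENNReal.ofReal_add (by positivity) (by positivity)]
  refine add_le_add
    (prob_sum_signedTrunc_nonpos_le hw hA hZ hlaw hind hC hM.le hm htail hmean hn) ?_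
  refine (measure_biUnion_finset_le _ _).trans ?_
  calc ∑ i ∈ Finset.range n, P (Z i ⁻¹' {p | ENNReal.ofReal M ≤ w p})
      ≤ ∑ _i ∈ Finset.range n, ENNReal.ofReal (C / M) := by
        refine Finset.sum_le_sum fun i _ => ?_
        rw [← Measure.map_apply (hZ i) (measurableSet_le measurable_const hw), hlaw i]
        exact htail M hM
    _ = ENNReal.ofReal (n * (C / M)) := by
        rw [Finset.sum_const, Finset.card_range, nsmul_eq_mul, ENNReal.ofReal_mul (by positivity),
          ENNReal.ofReal_natCast]

/-- If the tails of the weights are of order `1 / t`, and those of the weights in `A` exceed those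
of the weights in `Aᶜ` by a multiple of `1 / t`, then the sum of the weights in `A` dominates with
high probability. -/
theorem tendsto_prob_sum_indicator_le (hw : Measurable w) {A : Set T} (hA : MeasurableSet A)
    (hZ : ∀ i, Measurable (Z i)) (hlaw : ∀ i, P.map (Z i) = μ) (hind : iIndepFun Z P)
    {C c t₀ : ℝ} (hC : 0 ≤ C) (hc : 0 < c) (ht₀ : 0 < t₀)
    (htail : ∀ t, 0 < t → μ {p | ENNReal.ofReal t ≤ w p} ≤ ENNReal.ofReal (C / t))
    (hdrift : ∀ t, t₀ ≤ t → μ.restrict Aᶜ {p | ENNReal.ofReal t ≤ w p} + ENNReal.ofReal (c / t) ≤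
      μ.restrict A {p | ENNReal.ofReal t ≤ w p}) :
    Tendsto (fun n : ℕ => P {ω | ∑ i ∈ Finset.range n, A.indicator w (Z i ω) ≤
        ∑ i ∈ Finset.range n, Aᶜ.indicator w (Z i ω)}) atTop (𝓝 0) := by
  have hL : Tendsto (fun n : ℕ => Real.log n) atTop atTop :=
    Real.tendsto_log_atTop.comp tendsto_natCast_atTop_atTop
  -- The bound of `prob_sum_indicator_le` at `M = n * log n` and `m = c / 2 * log n`.
  have hlim : Tendsto (fun n : ℕ => ENNReal.ofReal ((8 * C / c ^ 2 + C) / Real.log n)) atTop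
      (𝓝 0) := by
    rw [← ENNReal.ofReal_zero]
    exact ENNReal.tendsto_ofReal (hL.const_div_atTop _)
  refine tendsto_of_tendsto_of_tendsto_of_le_of_le' tendsto_const_nhds hlim
    (Eventually.of_forall fun _ => zero_le) ?_
  -- The first entry gives `M ≥ n`; the second lets half of the drift `c * log n` absorb the
  -- constants depending on `t₀`.
  have hev1 := hL.eventually_ge_atTop (max 1 (2 / c * (c * Real.log t₀ + t₀)))
  have hev2 := tendsto_natCast_atTop_atTop.eventually_ge_atTop t₀
  filter_upwards [hev1, hev2, eventually_gt_atTop 0] with n h1 h2 hn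
  have hn' : (0 : ℝ) < n := Nat.cast_pos.2 hn
  set L := Real.log n with hLdef
  have hL1 : 1 ≤ L := (le_max_left _ _).trans h1
  have hL2 : c * Real.log t₀ + t₀ ≤ c / 2 * L := by
    have := (le_max_right _ _).trans h1
    rw [div_mul_eq_mul_div, div_le_iff₀ hc] at this
    linarith
  have hL0 : 0 < L := by linarith
  have hMn : (n : ℝ) ≤ n * L := le_mul_of_one_le_right hn'.le hL1
  have hlog : L - Real.log t₀ ≤ Real.log (n * L / t₀) := by
    rw [Real.log_div (by positivity) ht₀.ne']
    linarith [Real.log_le_log hn' hMn]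
  have hmean := integral_trunc_drift hw (ν₁ := μ.restrict A) (ν₂ := μ.restrict Aᶜ)
    (by rw [Measure.restrict_apply_univ]; exact prob_le_one) hc.le ht₀ (h2.trans hMn) hdrift
  have hmean' : c / 2 * L ≤ ∫ p in A, trunc w (n * L) p ∂μ - ∫ p in Aᶜ, trunc w (n * L) p ∂μ := by
    refine le_trans ?_ hmean
    have := mul_le_mul_of_nonneg_left hlog hc.le
    linarith
  refine (prob_sum_indicator_le hw hA hZ hlaw hind hC (by positivity) (by positivity) htail hmean'
    hn).trans (ENNReal.ofReal_le_ofReal (le_of_eq ?_))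
  field_simp
  ring

end HeavyTailsLimit

/-! ### The classifier at a point of differentiability -/

section Pointwise

open Set Topology Metric InnerProductGeometry

variable {d : ℕ}

instance discreteMeasurableSpace_intUnits : DiscreteMeasurableSpace ℤˣ where
  forall_measurableSet s := ⟨Units.val '' s, MeasurableSet.of_discrete,
    Set.preimage_image_eq s Units.val_injective⟩

/-- The Hilbert kernel `angle(x, z)^(-d)` of the sphere. -/
noncomputable def hilbertKernel (d : ℕ) (x z : Sphere d) : ℝ≥0∞ :=
  (ENNReal.ofReal (angle x.1 z.1) ^ d)⁻¹

theorem measurable_hilbertKernel (d : ℕ) :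
    Measurable fun p : Sphere d × Sphere d => hilbertKernel d p.1 p.2 := by
  have h : Measurable fun p : Sphere d × Sphere d => angle p.1.1 p.2.1 := by
    unfold InnerProductGeometry.angle
    fun_prop
  exact (h.ennreal_ofReal.pow_const d).inv

/-- The metric on the sphere is the chordal one, whereas the kernel is a function of the angle; this
is chord length against arc length. -/
theorem dist_eq_two_mul_sin (x y : Sphere d) : dist x y = 2 * Real.sin (angle x.1 y.1 / 2) := by
  have hx : ‖x.1‖ = 1 := by simp
  have hy : ‖y.1‖ = 1 := by simp
  have hs : 0 ≤ Real.sin (angle x.1 y.1 / 2) := Real.sin_nonneg_of_nonneg_of_le_pi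
    (by linarith [angle_nonneg x.1 y.1]) (by linarith [angle_le_pi x.1 y.1, Real.pi_pos])
  rw [← pow_left_inj₀ dist_nonneg (by positivity) two_ne_zero, Subtype.dist_eq, dist_eq_norm,
    norm_sub_sq_real, hx, hy, ← cos_angle_mul_norm_mul_norm x.1 y.1, hx, hy, mul_pow,
    Real.sin_sq_eq_half_sub]
  ring_nf

/-- The superlevel sets of the Hilbert kernel are balls of volume comparable to `1 / t`. -/
theorem exists_hilbertKernel_level_radius (hd : 0 < d) {t : ℝ} (ht : 1 ≤ t) :
    ∃ r : ℝ, 0 < r ∧ r ≤ 2 ∧ (2 / Real.pi) ^ d / t ≤ r ^ d ∧ r ^ d ≤ 1 / t ∧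
      ∀ x y : Sphere d, ENNReal.ofReal t ≤ hilbertKernel d x y ↔ y ∈ closedBall x r := by
  have ht0 : 0 < t := by linarith
  -- The angle at which the kernel equals `t`. The radius is the corresponding chord, comparable to
  -- `τ` by Jordan's inequality.
  set τ : ℝ := t⁻¹ ^ ((d : ℝ)⁻¹) with hτ
  have hτ0 : 0 < τ := by positivity
  have hτd : τ ^ d = t⁻¹ := Real.rpow_inv_natCast_pow (by positivity) hd.ne'
  have hτ1 : τ ≤ 1 := Real.rpow_le_one (by positivity) (inv_le_one_of_one_le₀ ht) (by positivity)
  have hpi := Real.pi_gt_three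
  have hrτ : 2 * Real.sin (τ / 2) ≤ τ := by linarith [Real.sin_le (x := τ / 2) (by positivity)]
  have hτr : 2 / Real.pi * τ ≤ 2 * Real.sin (τ / 2) := by
    have := Real.mul_le_sin (x := τ / 2) (by positivity) (by linarith)
    linarith
  have hr0 : 0 < 2 * Real.sin (τ / 2) := lt_of_lt_of_le (by positivity) hτr
  refine ⟨2 * Real.sin (τ / 2), hr0, by linarith, ?_, ?_, fun x y => ?_⟩
  · rw [div_eq_mul_inv, ← hτd, ← mul_pow]
    exact pow_le_pow_left₀ (by positivity) hτr d
  · rw [one_div, ← hτd]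
    exact pow_le_pow_left₀ hr0.le hrτ d
  · have ha0 := angle_nonneg x.1 y.1
    have hapi := angle_le_pi x.1 y.1
    rw [hilbertKernel, ENNReal.le_inv_iff_le_inv, ← ENNReal.ofReal_inv_of_pos ht0,
      ← ENNReal.ofReal_pow ha0, ENNReal.ofReal_le_ofReal_iff (by positivity), ← hτd,
      pow_le_pow_iff_left₀ ha0 hτ0.le hd.ne', mem_closedBall, dist_comm, dist_eq_two_mul_sin,
      mul_le_mul_iff_right₀ two_pos, Real.strictMonoOn_sin.le_iff_le]
    · constructor <;> intro h <;> linarith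
    · exact ⟨by linarith, by linarith⟩
    · exact ⟨by linarith, by linarith⟩

/-- The part with label `s` of the distribution of the points. -/
noncomputable def labelLaw {S : Type*} [MeasurableSpace S] (μ : Measure (S × ℤˣ)) (s : ℤˣ) :
    Measure S :=
  (μ.restrict {p | p.2 = s}).fst

instance isFiniteMeasure_labelLaw {S : Type*} [MeasurableSpace S] (μ : Measure (S × ℤˣ))
    [IsFiniteMeasure μ] (s : ℤˣ) : IsFiniteMeasure (labelLaw μ s) := by
  unfold labelLaw; infer_instance

theorem compl_setOf_snd_eq {S : Type*} (s : ℤˣ) :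
    {p : S × ℤˣ | p.2 = s}ᶜ = {p | p.2 = -s} := by
  ext p
  simp only [mem_compl_iff, mem_ofPred_eq]
  rcases Int.units_eq_one_or p.2 with h | h <;> rcases Int.units_eq_one_or s with h' | h' <;>
    rw [h, h'] <;> decide

theorem measurableSet_setOf_snd_eq {S : Type*} [MeasurableSpace S] (s : ℤˣ) :
    MeasurableSet {p : S × ℤˣ | p.2 = s} :=
  measurable_snd (MeasurableSet.of_discrete (s := {s}))

theorem labelLaw_add_labelLaw_neg {S : Type*} [MeasurableSpace S] (μ : Measure (S × ℤˣ)) (s : ℤˣ)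
    (B : Set S) (hB : MeasurableSet B) :
    labelLaw μ s B + labelLaw μ (-s) B = μ (Prod.fst ⁻¹' B) := by
  rw [labelLaw, labelLaw, Measure.fst_apply hB, Measure.fst_apply hB, ← compl_setOf_snd_eq,
    ← Measure.add_apply, Measure.restrict_add_restrict_compl (measurableSet_setOf_snd_eq s)]

theorem labelMass_eq_sum_indicator {M : Type*} (K : M → M → ℝ≥0∞) (n : ℕ) (D : ℕ → M × ℤˣ) (x : M)
    (s : ℤˣ) : labelMass K (fun j : Fin n => D j) x s =
      ∑ i ∈ Finset.range n, {p : M × ℤˣ | p.2 = s}.indicator (fun p => K x p.1) (D i) := by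
  classical
  rw [labelMass, Finset.sum_range]
  simp only [indicator_apply]
  rfl

/-- At a point where the density of `ν₁` exceeds the density of `ν₂`, the tails of the Hilbert
kernel under `ν₁` exceed those under `ν₂` by a multiple of `1 / t`. -/
theorem exists_hilbertKernel_tail_bounds (hd : 0 < d) (x : Sphere d) {ν₁ ν₂ : Measure (Sphere d)}
    (hν : ∀ B, ν₁ B + ν₂ B ≤ 1) {a b : ℝ≥0∞} (ha : a ≠ ⊤) (hab : b < a)
    (h₁ : Tendsto (fun r => ν₁ (closedBall x r) / sphereVolume d (closedBall x r))
      (𝓝[>] 0) (𝓝 a))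
    (h₂ : Tendsto (fun r => ν₂ (closedBall x r) / sphereVolume d (closedBall x r))
      (𝓝[>] 0) (𝓝 b)) :
    ∃ C c t₀ : ℝ, 0 ≤ C ∧ 0 < c ∧ 0 < t₀ ∧
      (∀ t, 0 < t → ν₁ {y | ENNReal.ofReal t ≤ hilbertKernel d x y} +
        ν₂ {y | ENNReal.ofReal t ≤ hilbertKernel d x y} ≤ ENNReal.ofReal (C / t)) ∧
      ∀ t, t₀ ≤ t → ν₂ {y | ENNReal.ofReal t ≤ hilbertKernel d x y} + ENNReal.ofReal (c / t) ≤
        ν₁ {y | ENNReal.ofReal t ≤ hilbertKernel d x y} := by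
  -- Finite constants `b < b' < a' < a < e`: on small balls the ratio is below `b'` for `ν₂` and
  -- between `a'` and `e` for `ν₁`.
  obtain ⟨b', hbb', hb'a⟩ := ENNReal.lt_iff_exists_nnreal_btwn.1 hab
  obtain ⟨a', hb'a', ha'a⟩ := ENNReal.lt_iff_exists_nnreal_btwn.1 hb'a
  obtain ⟨e, hae, -⟩ := ENNReal.lt_iff_exists_nnreal_btwn.1 (lt_top_iff_ne_top.2 ha)
  obtain ⟨C, hC, hup⟩ := sphereVolume_closedBall_le d
  obtain ⟨c, hc, hlow⟩ := le_sphereVolume_closedBall d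
  have hvol0 : ∀ r : ℝ, 0 < r → r ≤ 2 → sphereVolume d (closedBall x r) ≠ 0 := fun r h0 h2 =>
    (lt_of_lt_of_le (ENNReal.ofReal_pos.2 (by positivity)) (hlow x r h0.le h2)).ne'
  have hvolT : ∀ r : ℝ, sphereVolume d (closedBall x r) ≠ ⊤ := fun r => measure_ne_top _ _
  obtain ⟨δ, hδ0, hδ⟩ : ∃ δ > (0 : ℝ), ∀ r, 0 < r → r ≤ 2 → r < δ →
      ν₂ (closedBall x r) ≤ b' * sphereVolume d (closedBall x r) ∧
      a' * sphereVolume d (closedBall x r) ≤ ν₁ (closedBall x r) ∧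
      ν₁ (closedBall x r) ≤ e * sphereVolume d (closedBall x r) := by
    have hev := (h₂.eventually_lt_const hbb').and
      ((h₁.eventually_const_lt ha'a).and (h₁.eventually_lt_const hae))
    obtain ⟨δ, hδ0, hδ⟩ := mem_nhdsGT_iff_exists_Ioo_subset.1 hev
    refine ⟨δ, hδ0, fun r h0 h2 hr => ?_⟩
    obtain ⟨h1, h2', h3⟩ := hδ ⟨h0, hr⟩
    exact ⟨(ENNReal.div_le_iff (hvol0 r h0 h2) (hvolT r)).1 h1.le,
      (ENNReal.le_div_iff_mul_le (Or.inl (hvol0 r h0 h2)) (Or.inl (hvolT r))).1 h2'.le,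
      (ENNReal.div_le_iff (hvol0 r h0 h2) (hvolT r)).1 h3.le⟩
  have hab' : (0 : ℝ) < a' - b' := sub_pos.2 (by exact_mod_cast hb'a')
  obtain ⟨t₀, ht₀1, ht₀δ⟩ : ∃ t₀ : ℝ, 1 ≤ t₀ ∧ (δ ^ d)⁻¹ < t₀ :=
    ⟨max 1 ((δ ^ d)⁻¹ + 1), le_max_left _ _, (lt_add_one _).trans_le (le_max_right _ _)⟩
  have hsmall : ∀ t r : ℝ, t₀ ≤ t → 0 < r → r ^ d ≤ 1 / t → r < δ := by
    intro t r ht hr hrt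
    by_contra! hcon
    have h1 : δ ^ d ≤ 1 / t := (pow_le_pow_left₀ hδ0.le hcon d).trans hrt
    have h2 : t ≤ (δ ^ d)⁻¹ := by
      rw [le_inv_comm₀ (by linarith) (pow_pos hδ0 d), ← one_div]; exact h1
    linarith
  have hset : ∀ t r : ℝ, (∀ x y : Sphere d, ENNReal.ofReal t ≤ hilbertKernel d x y ↔
      y ∈ closedBall x r) → {y | ENNReal.ofReal t ≤ hilbertKernel d x y} = closedBall x r :=
    fun t r h => Set.ext fun y => h x y
  -- The entry `t₀` in the maximum covers `t < t₀`, where the total mass is at most `1 ≤ t₀ / t`.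
  refine ⟨max t₀ ((e + b') * C), (a' - b') * c * (2 / Real.pi) ^ d, t₀,
    le_trans (by linarith) (le_max_left _ _),
    mul_pos (mul_pos hab' hc) (pow_pos (div_pos two_pos Real.pi_pos) d), by linarith,
    fun t ht => ?_, fun t htt => ?_⟩
  · by_cases htt : t₀ ≤ t
    · obtain ⟨r, hr0, hr2, -, hrt, hlev⟩ := exists_hilbertKernel_level_radius hd (ht₀1.trans htt)
      obtain ⟨h1, -, h3⟩ := hδ r hr0 hr2 (hsmall t r htt hr0 hrt)
      rw [hset t r hlev]
      refine (add_le_add h3 h1).trans ?_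
      rw [← add_mul]
      refine (mul_le_mul_right (hup x r hr0.le) _).trans ?_
      have heb : ((e : ℝ≥0∞) + b') = ENNReal.ofReal (e + b') := by
        rw [ENNReal.ofReal_add e.coe_nonneg b'.coe_nonneg, ENNReal.ofReal_coe_nnreal,
          ENNReal.ofReal_coe_nnreal]
      rw [heb, ← ENNReal.ofReal_mul (by positivity)]
      refine ENNReal.ofReal_le_ofReal ?_
      calc ((e : ℝ) + b') * (C * r ^ d) ≤ (e + b') * (C * (1 / t)) := by gcongr
        _ = (e + b') * C / t := by ring
        _ ≤ max t₀ ((e + b') * C) / t := by gcongr; exact le_max_right _ _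
    · refine (hν _).trans ?_
      rw [ENNReal.one_le_ofReal, one_le_div ht]
      exact (not_le.1 htt).le.trans (le_max_left _ _)
  · obtain ⟨r, hr0, hr2, hrl, hrt, hlev⟩ := exists_hilbertKernel_level_radius hd (ht₀1.trans htt)
    obtain ⟨h1, h2, -⟩ := hδ r hr0 hr2 (hsmall t r htt hr0 hrt)
    rw [hset t r hlev]
    refine le_trans ?_ h2
    have ha'b' : (a' : ℝ≥0∞) = b' + ENNReal.ofReal (a' - b') := by
      rw [← ENNReal.ofReal_coe_nnreal, ← ENNReal.ofReal_coe_nnreal (p := b'),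
        ← ENNReal.ofReal_add b'.coe_nonneg hab'.le, add_sub_cancel]
    rw [ha'b', add_mul]
    refine add_le_add h1 (le_trans ?_ (mul_le_mul_right (hlow x r hr0.le hr2) _))
    rw [← ENNReal.ofReal_mul hab'.le]
    refine ENNReal.ofReal_le_ofReal ?_
    calc ((a' : ℝ) - b') * c * (2 / Real.pi) ^ d / t
        = (a' - b') * (c * ((2 / Real.pi) ^ d / t)) := by ring
      _ ≤ (a' - b') * (c * r ^ d) :=
        mul_le_mul_of_nonneg_left (mul_le_mul_of_nonneg_left hrl hc.le) hab'.le

variable {Ω : Type*} [MeasurableSpace Ω] {P : Measure Ω} [IsProbabilityMeasure P]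
  {μ : Measure (Sphere d × ℤˣ)} [IsProbabilityMeasure μ] {Z : ℕ → Ω → Sphere d × ℤˣ}

/-- At a point where the density of the label `s` exceeds the density of the label `-s`, the
Hilbert kernel classifier predicts `s` with high probability. -/
theorem tendsto_prob_sgn_ensemble_ne (hd : 0 < d)
    (hZ : ∀ i, Measurable (Z i)) (hlaw : ∀ i, P.map (Z i) = μ) (hind : iIndepFun Z P)
    (s : ℤˣ) (x : Sphere d) {a b : ℝ≥0∞} (ha : a ≠ ⊤) (hab : b < a)
    (hs : Tendsto (fun r => labelLaw μ s (closedBall x r) / sphereVolume d (closedBall x r))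
      (𝓝[>] 0) (𝓝 a))
    (hns : Tendsto (fun r => labelLaw μ (-s) (closedBall x r) / sphereVolume d (closedBall x r))
      (𝓝[>] 0) (𝓝 b)) :
    Tendsto (fun n : ℕ => P {ω | sgn (ensemble (hilbertKernel d) (fun j : Fin n => Z j ω) x) ≠ s})
      atTop (𝓝 0) := by
  have hν : ∀ B, labelLaw μ s B + labelLaw μ (-s) B ≤ 1 := fun B =>
    (add_le_add (measure_mono (subset_univ B)) (measure_mono (subset_univ B))).trans (by
      rw [labelLaw_add_labelLaw_neg μ s univ MeasurableSet.univ]; exact prob_le_one)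
  obtain ⟨C, c, t₀, hC, hc, ht₀, htail, hdrift⟩ :=
    exists_hilbertKernel_tail_bounds hd x hν ha hab hs hns
  have hK : Measurable (hilbertKernel d x) := by
    have h := (measurable_hilbertKernel d).comp (measurable_prodMk_left (x := x))
    exact h
  have hlev : ∀ t : ℝ, MeasurableSet {y | ENNReal.ofReal t ≤ hilbertKernel d x y} := fun t =>
    measurableSet_le measurable_const hK
  have hmain := tendsto_prob_sum_indicator_le (w := fun p : Sphere d × ℤˣ => hilbertKernel d x p.1)
    (hK.comp measurable_fst) (measurableSet_setOf_snd_eq (S := Sphere d) s) hZ hlaw hind hC hc ht₀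
    (fun t ht => by
      have := htail t ht
      rwa [labelLaw_add_labelLaw_neg μ s _ (hlev t)] at this)
    (fun t ht => by
      have := hdrift t ht
      rwa [labelLaw, labelLaw, Measure.fst_apply (hlev t), Measure.fst_apply (hlev t),
        ← compl_setOf_snd_eq] at this)
  refine tendsto_of_tendsto_of_tendsto_of_le_of_le tendsto_const_nhds hmain (fun _ => zero_le)
    fun n => measure_mono fun ω hω => ?_
  by_contra hcon
  refine hω (sgn_ensemble_eq_of_lt _ _ _ ?_)
  rw [labelMass_eq_sum_indicator (hilbertKernel d) n (fun j => Z j ω) x,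
    labelMass_eq_sum_indicator (hilbertKernel d) n (fun j => Z j ω) x, ← compl_setOf_snd_eq]
  exact not_le.1 hcon

end Pointwise

/-! ### Excess risk -/

section Risk

open Set Topology

variable {S : Type*} [MeasurableSpace S] {vol : Measure S} {μ : Measure (S × ℤˣ)}

/-- The density with respect to `vol` of the points with label `s`. -/
noncomputable def labelDensity (vol : Measure S) (μ : Measure (S × ℤˣ)) (s : ℤˣ) : S → ℝ≥0∞ :=
  (labelLaw μ s).rnDeriv vol

theorem measurable_labelDensity (vol : Measure S) (μ : Measure (S × ℤˣ)) (s : ℤˣ) :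
    Measurable (labelDensity vol μ s) := Measure.measurable_rnDeriv _ _

theorem labelLaw_absolutelyContinuous (h : HasDensity vol μ.fst) (s : ℤˣ) :
    labelLaw μ s ≪ vol := by
  obtain ⟨f, -, hf⟩ := h
  have h1 : labelLaw μ s ≪ μ.fst :=
    (Measure.map_mono Measure.restrict_le_self measurable_fst).absolutelyContinuous
  refine h1.trans (Measure.AbsolutelyContinuous.mk fun B hB h0 => ?_)
  rw [hf B hB, Measure.restrict_eq_zero.2 h0, lintegral_zero_measure]

theorem units_ne_iff_eq_neg {s t : ℤˣ} : s ≠ t ↔ s = -t := by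
  rcases Int.units_eq_one_or s with rfl | rfl <;> rcases Int.units_eq_one_or t with rfl | rfl <;>
    decide

/-- The Bayes classifier. -/
noncomputable def bayesClassifier (vol : Measure S) (μ : Measure (S × ℤˣ)) (x : S) : ℤˣ :=
  open Classical in if labelDensity vol μ (-1) x ≤ labelDensity vol μ 1 x then 1 else -1

theorem measurable_bayesClassifier (vol : Measure S) (μ : Measure (S × ℤˣ)) :
    Measurable (bayesClassifier vol μ) :=
  Measurable.ite (measurableSet_le (measurable_labelDensity vol μ _)
    (measurable_labelDensity vol μ _)) measurable_const measurable_const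

/-- The absolute difference of the densities of the two labels. -/
noncomputable def densityGap (vol : Measure S) (μ : Measure (S × ℤˣ)) (x : S) : ℝ≥0∞ :=
  (labelDensity vol μ 1 x - labelDensity vol μ (-1) x) +
    (labelDensity vol μ (-1) x - labelDensity vol μ 1 x)

theorem measurable_densityGap (vol : Measure S) (μ : Measure (S × ℤˣ)) :
    Measurable (densityGap vol μ) :=
  ((measurable_labelDensity vol μ _).sub (measurable_labelDensity vol μ _)).add
    ((measurable_labelDensity vol μ _).sub (measurable_labelDensity vol μ _))

/-- Predicting `s` at `x` errs with density that of the label `-s`, so this is pointwise optimality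
of the Bayes rule. -/
theorem labelDensity_neg_bayesClassifier_le (s : ℤˣ) (x : S) :
    labelDensity vol μ (-bayesClassifier vol μ x) x ≤ labelDensity vol μ (-s) x := by
  unfold bayesClassifier
  split_ifs with h <;> rcases Int.units_eq_one_or s with rfl | rfl
  · exact le_rfl
  · rwa [neg_neg]
  · rw [neg_neg]; exact (not_le.1 h).le
  · exact le_rfl

theorem labelDensity_neg_le_add_densityGap (s : ℤˣ) (x : S) :
    labelDensity vol μ (-s) x ≤
      labelDensity vol μ (-bayesClassifier vol μ x) x + densityGap vol μ x := by
  have h1 : labelDensity vol μ 1 x ≤ labelDensity vol μ (-1) x + densityGap vol μ x :=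
    le_add_tsub.trans (add_le_add_right le_self_add _)
  have h2 : labelDensity vol μ (-1) x ≤ labelDensity vol μ 1 x + densityGap vol μ x :=
    le_add_tsub.trans (add_le_add_right le_add_self _)
  unfold bayesClassifier
  split_ifs with h <;> rcases Int.units_eq_one_or s with rfl | rfl
  · exact le_self_add
  · rwa [neg_neg]
  · rwa [neg_neg]
  · exact le_self_add

variable [IsProbabilityMeasure μ]

theorem lintegral_densityGap_ne_top : ∫⁻ x, densityGap vol μ x ∂vol ≠ ⊤ := by
  refine ne_top_of_le_ne_top (b := ∫⁻ x, labelDensity vol μ 1 x + labelDensity vol μ (-1) x ∂vol)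
    ?_ (lintegral_mono fun x => add_le_add tsub_le_self tsub_le_self)
  rw [lintegral_add_left (measurable_labelDensity vol μ 1)]
  exact ENNReal.add_ne_top.2
    ⟨(Measure.lintegral_rnDeriv_lt_top _ _).ne, (Measure.lintegral_rnDeriv_lt_top _ _).ne⟩

variable [IsFiniteMeasure vol]

/-- With two labels an error at `x` means that the label is `-f x`; splitting over the two values of
`f` fixes which label density to integrate. -/
theorem measure_misclassified (hac : ∀ s, labelLaw μ s ≪ vol) {f : S → ℤˣ} (hf : Measurable f) :
    μ {z | f z.1 ≠ z.2} = ∫⁻ x, labelDensity vol μ (-f x) x ∂vol := by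
  have hm : ∀ s, MeasurableSet {x | f x = s} := fun s => hf (MeasurableSet.of_discrete (s := {s}))
  have hone : ∀ s, labelLaw μ (-s) {x | f x = s} =
      ∫⁻ x in {x | f x = s}, labelDensity vol μ (-f x) x ∂vol := by
    intro s
    rw [← Measure.setLIntegral_rnDeriv (hac (-s))]
    refine setLIntegral_congr_fun (hm s) fun x hx => ?_
    have hx' : f x = s := hx
    rw [hx']
    rfl
  have hlab : ∀ s, labelLaw μ (-s) {x | f x = s} = μ ({z | f z.1 ≠ z.2} ∩ {z | z.2 = -s}) := by
    intro s
    rw [labelLaw, Measure.fst_apply (hm s), Measure.restrict_apply (measurable_fst (hm s))]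
    congr 1
    ext z
    simp only [mem_inter_iff, mem_preimage, mem_ofPred_eq, and_congr_left_iff]
    intro hz
    rw [hz, units_ne_iff_eq_neg, neg_neg]
  have hcompl : {x | f x = 1}ᶜ = {x | f x = -1} := by
    ext x
    exact units_ne_iff_eq_neg
  rw [← lintegral_add_compl _ (hm 1), hcompl, ← hone, ← hone, hlab, hlab, neg_neg,
    ← compl_setOf_snd_eq, add_comm, ← sdiff_eq,
    measure_inter_add_sdiff _ (measurableSet_setOf_snd_eq 1)]

theorem measure_misclassified_le (hac : ∀ s, labelLaw μ s ≪ vol) {f : S → ℤˣ}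
    (hf : Measurable f) :
    μ {z | f z.1 ≠ z.2} ≤ μ {z | bayesClassifier vol μ z.1 ≠ z.2} +
      ∫⁻ x in {x | f x ≠ bayesClassifier vol μ x}, densityGap vol μ x ∂vol := by
  classical
  have hb := measurable_bayesClassifier vol μ
  have hne : MeasurableSet {x | f x ≠ bayesClassifier vol μ x} :=
    (measurableSet_eq_fun hf hb).compl
  rw [measure_misclassified hac hf, measure_misclassified hac hb, ← lintegral_indicator hne,
    ← lintegral_add_right _ ((measurable_densityGap vol μ).indicator hne)]
  refine lintegral_mono fun x => ?_
  by_cases hx : f x = bayesClassifier vol μ x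
  · rw [hx]; exact le_self_add
  · rw [indicator_of_mem (show x ∈ {x | f x ≠ bayesClassifier vol μ x} from hx)]
    exact labelDensity_neg_le_add_densityGap (f x) x

theorem risk_bayesClassifier_le (hac : ∀ s, labelLaw μ s ≪ vol) {f : S → ℤˣ}
    (hf : Measurable f) : risk μ (bayesClassifier vol μ) ≤ risk μ f := by
  refine ENNReal.toReal_mono (measure_ne_top _ _) ?_
  rw [measure_misclassified hac hf, measure_misclassified hac (measurable_bayesClassifier vol μ)]
  exact lintegral_mono fun x => labelDensity_neg_bayesClassifier_le (f x) x

theorem bayesRisk_eq (hac : ∀ s, labelLaw μ s ≪ vol) :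
    bayesRisk μ = risk μ (bayesClassifier vol μ) := by
  have : Nonempty {f : S → ℤˣ // Measurable f} := ⟨⟨_, measurable_bayesClassifier vol μ⟩⟩
  refine le_antisymm ?_ (le_ciInf fun f => risk_bayesClassifier_le hac f.2)
  exact ciInf_le ⟨0, by rintro _ ⟨f, rfl⟩; exact measureReal_nonneg⟩
    (⟨_, measurable_bayesClassifier vol μ⟩ : {f : S → ℤˣ // Measurable f})

theorem edist_risk_bayesRisk_le (hac : ∀ s, labelLaw μ s ≪ vol) {f : S → ℤˣ}
    (hf : Measurable f) : edist (risk μ f) (bayesRisk μ) ≤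
      ∫⁻ x in {x | f x ≠ bayesClassifier vol μ x}, densityGap vol μ x ∂vol := by
  have hfin : ∫⁻ x in {x | f x ≠ bayesClassifier vol μ x}, densityGap vol μ x ∂vol ≠ ⊤ :=
    ne_top_of_le_ne_top lintegral_densityGap_ne_top (setLIntegral_le_lintegral _ _)
  have h1 := measure_misclassified_le hac hf
  have h2 := risk_bayesClassifier_le hac hf
  rw [bayesRisk_eq hac, edist_dist, Real.dist_eq, abs_of_nonneg (sub_nonneg.2 h2)]
  refine ENNReal.ofReal_le_of_le_toReal ?_
  have h3 := ENNReal.toReal_mono (ENNReal.add_ne_top.2 ⟨measure_ne_top _ _, hfin⟩) h1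
  rw [ENNReal.toReal_add (measure_ne_top _ _) hfin] at h3
  simp only [risk, Measure.real]
  linarith

variable {Ω : Type*} [MeasurableSpace Ω] {P : Measure Ω} [IsProbabilityMeasure P]

/-- A sequence of random classifiers that at almost every point eventually predicts the more likely
label with high probability is consistent. -/
theorem tendstoInMeasure_risk (hac : ∀ s, labelLaw μ s ≪ vol) {fhat : ℕ → Ω → S → ℤˣ}
    (hfhat : ∀ n, Measurable fun q : Ω × S => fhat n q.1 q.2)
    (h : ∀ᵐ x ∂vol, ∀ s, labelDensity vol μ (-s) x < labelDensity vol μ s x →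
      Tendsto (fun n => P {ω | fhat n ω x ≠ s}) atTop (𝓝 0)) :
    TendstoInMeasure P (fun n ω => risk μ (fhat n ω)) atTop (fun _ => bayesRisk μ) := by
  have hb := measurable_bayesClassifier vol μ
  have hg := measurable_densityGap vol μ
  have hB : ∀ n, MeasurableSet {q : Ω × S | fhat n q.1 q.2 ≠ bayesClassifier vol μ q.2} :=
    fun n => (measurableSet_eq_fun (hfhat n) (hb.comp measurable_snd)).compl
  have hsec : ∀ n ω, Measurable (fhat n ω) := fun n ω => (hfhat n).comp measurable_prodMk_left
  set E : ℕ → Ω → ℝ≥0∞ := fun n ω =>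
    ∫⁻ x in {x | fhat n ω x ≠ bayesClassifier vol μ x}, densityGap vol μ x ∂vol with hE
  set G : ℕ → Ω × S → ℝ≥0∞ := fun n =>
    {q : Ω × S | fhat n q.1 q.2 ≠ bayesClassifier vol μ q.2}.indicator
      fun q => densityGap vol μ q.2 with hG
  have hGm : ∀ n, Measurable (G n) := fun n => (hg.comp measurable_snd).indicator (hB n)
  have hEG : ∀ n ω, E n ω = ∫⁻ x, G n (ω, x) ∂vol := by
    intro n ω
    have hx : MeasurableSet {x | fhat n ω x ≠ bayesClassifier vol μ x} :=
      measurable_prodMk_left (hB n)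
    rw [hE]
    simp only
    rw [← lintegral_indicator hx]
    rfl
  have hEm : ∀ n, Measurable (E n) := fun n => by
    rw [show E n = fun ω => ∫⁻ x, G n (ω, x) ∂vol from funext (hEG n)]
    exact (hGm n).lintegral_prod_right'
  -- Tonelli turns the expected excess risk into pointwise disagreement probabilities, dominated by
  -- the integrable density gap.
  have hEint : ∀ n, ∫⁻ ω, E n ω ∂P =
      ∫⁻ x, densityGap vol μ x * P {ω | fhat n ω x ≠ bayesClassifier vol μ x} ∂vol := by
    intro n
    simp_rw [hEG]
    rw [lintegral_lintegral_swap (f := fun ω x => G n (ω, x)) (hGm n).aemeasurable]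
    refine lintegral_congr fun x => ?_
    have hx : MeasurableSet {ω | fhat n ω x ≠ bayesClassifier vol μ x} :=
      measurable_prodMk_right (hB n)
    rw [← lintegral_indicator_const hx]
    rfl
  have hlim : Tendsto (fun n => ∫⁻ ω, E n ω ∂P) atTop (𝓝 0) := by
    simp_rw [hEint]
    rw [← lintegral_zero (μ := vol)]
    refine tendsto_lintegral_of_dominated_convergence (densityGap vol μ)
      (fun n => hg.mul (measurable_measure_prodMk_right (hB n)))
      (fun n => Eventually.of_forall fun x => mul_le_of_le_one_right' prob_le_one)
      lintegral_densityGap_ne_top ?_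
    filter_upwards [h, ae_lt_top hg lintegral_densityGap_ne_top] with x hx hgx
    rcases lt_trichotomy (labelDensity vol μ (-1) x) (labelDensity vol μ 1 x) with hlt | heq | hlt
    · have hbx : bayesClassifier vol μ x = 1 := if_pos hlt.le
      rw [hbx]
      simpa using ENNReal.Tendsto.const_mul (hx 1 hlt) (Or.inr hgx.ne)
    -- On ties the prediction may oscillate, but it carries no excess risk.
    · have : densityGap vol μ x = 0 := by simp [densityGap, heq]
      simp [this]
    · have hbx : bayesClassifier vol μ x = -1 := if_neg (not_le.2 hlt)
      rw [hbx]
      simpa using ENNReal.Tendsto.const_mul (hx (-1) (by rwa [neg_neg])) (Or.inr hgx.ne)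
  intro ε hε
  -- Markov's inequality needs a finite threshold, and `ε` may be `⊤`.
  have hε' : min ε 1 ≠ 0 := (lt_min hε one_pos).ne'
  have hεT : min ε 1 ≠ ⊤ := ne_top_of_le_ne_top ENNReal.one_ne_top (min_le_right _ _)
  have hbound : Tendsto (fun n => (∫⁻ ω, E n ω ∂P) / min ε 1) atTop (𝓝 0) := by
    simpa using ENNReal.Tendsto.div_const hlim (Or.inr hε')
  refine tendsto_of_tendsto_of_tendsto_of_le_of_le tendsto_const_nhds hbound (fun _ => zero_le)
    fun n => ?_
  refine (measure_mono fun ω hω => ?_).trans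
    (meas_ge_le_lintegral_div (hEm n).aemeasurable hε' hεT)
  exact (min_le_left _ _).trans (le_trans hω (edist_risk_bayesRisk_le hac (hsec n ω)))

end Risk

/-! ### Joint measurability, distinct sample points and the assembled property -/

section Consistency

open Set Topology

variable {d : ℕ} {Ω : Type*} [MeasurableSpace Ω] {P : Measure Ω} [IsProbabilityMeasure P]

/-- The sign is decided by comparing two `ℝ≥0∞`-valued masses, each a finite sum of measurable
functions. Joint measurability is what Tonelli needs. -/
theorem measurable_sgn_ensemble {M : Type*} [MeasurableSpace M] {K : M → M → ℝ≥0∞}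
    (hK : Measurable fun p : M × M => K p.1 p.2) {n : ℕ} {Z : Fin n → Ω → M × ℤˣ}
    (hZ : ∀ i, Measurable (Z i)) :
    Measurable fun q : Ω × M => sgn (ensemble K (fun j => Z j q.1) q.2) := by
  classical
  have hmass : ∀ s, Measurable fun q : Ω × M => labelMass K (fun j => Z j q.1) q.2 s := by
    intro s
    unfold labelMass
    refine Finset.measurable_sum _ fun i _ => Measurable.ite ?_ ?_ measurable_const
    · exact ((hZ i).comp measurable_fst) (measurableSet_setOf_snd_eq s)
    · exact hK.comp (measurable_snd.prodMk ((hZ i).fst.comp measurable_fst))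
  have heq : (fun q : Ω × M => sgn (ensemble K (fun j => Z j q.1) q.2)) = fun q : Ω × M =>
      if labelMass K (fun j => Z j q.1) q.2 (-1) ≠ ⊤ ∧
        labelMass K (fun j => Z j q.1) q.2 (-1) ≤ labelMass K (fun j => Z j q.1) q.2 1
      then (1 : ℤˣ) else -1 := by
    funext q
    split_ifs with hq
    · exact (sgn_ensemble_eq_one_iff K _ _).2 hq
    · exact (Int.units_eq_one_or _).resolve_left fun hc => hq ((sgn_ensemble_eq_one_iff K _ _).1 hc)
  rw [heq]
  refine Measurable.ite (MeasurableSet.inter ?_ (measurableSet_le (hmass _) (hmass _)))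
    measurable_const measurable_const
  exact (measurableSet_eq_fun (hmass (-1)) measurable_const).compl

/-- Independent points with an atomless distribution are almost surely distinct. -/
theorem ae_fst_ne {M : Type*} [MeasurableSpace M] [TopologicalSpace M] [T2Space M]
    [SecondCountableTopology M] [BorelSpace M] {μ : Measure (M × ℤˣ)} [IsProbabilityMeasure μ]
    (hμ : ∀ x, μ.fst {x} = 0) {Z : ℕ → Ω → M × ℤˣ} (hZ : ∀ i, Measurable (Z i))
    (hlaw : ∀ i, P.map (Z i) = μ) (hind : iIndepFun Z P) :
    ∀ᵐ ω ∂P, ∀ i j, i ≠ j → (Z i ω).1 ≠ (Z j ω).1 := by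
  rw [ae_all_iff]
  intro i
  rw [ae_all_iff]
  intro j
  by_cases hij : i = j
  · simp [hij]
  have hX : ∀ i, Measurable fun ω => (Z i ω).1 := fun i => (hZ i).fst
  have hXlaw : ∀ i, P.map (fun ω => (Z i ω).1) = μ.fst := fun i => by
    rw [Measure.fst, ← hlaw i, Measure.map_map measurable_fst (hZ i)]
    rfl
  have hI : IndepFun (fun ω => (Z i ω).1) (fun ω => (Z j ω).1) P :=
    (hind.indepFun hij).comp measurable_fst measurable_fst
  have hmap := (indepFun_iff_map_prod_eq_prod_map_map (hX i).aemeasurable (hX j).aemeasurable).1 hI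
  have hdiag : MeasurableSet {p : M × M | p.1 = p.2} :=
    measurableSet_eq_fun measurable_fst measurable_snd
  -- The sections of the diagonal are single points, which are null for the atomless marginal.
  have h0 : P.map (fun ω => ((Z i ω).1, (Z j ω).1)) {p : M × M | p.1 = p.2} = 0 := by
    rw [hmap, hXlaw, hXlaw, Measure.measure_prod_null hdiag]
    refine Eventually.of_forall fun x => ?_
    have : Prod.mk x ⁻¹' {p : M × M | p.1 = p.2} = {x} := by
      ext y; exact eq_comm
    change μ.fst (Prod.mk x ⁻¹' {p : M × M | p.1 = p.2}) = 0
    rw [this]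
    exact hμ x
  rw [Measure.map_apply ((hX i).prodMk (hX j)) hdiag] at h0
  filter_upwards [measure_eq_zero_iff_ae_notMem.1 h0] with ω hω _ hc
  exact hω hc

theorem interpolatingConsistent_hilbertKernel.{v} (hd : 0 < d)
    (hK : ∀ x z, hilbertKernel d x z = ⊤ ↔ x = z) :
    InterpolatingConsistent.{v} (sphereVolume d)
      (fun _ D x => sgn (ensemble (hilbertKernel d) D x)) := by
  intro Ω _ P _ μ _ Z hZ hlaw hind hdens
  have hac := labelLaw_absolutelyContinuous hdens
  constructor
  · have hatom : ∀ x, μ.fst {x} = 0 := by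
      intro x
      obtain ⟨f, -, hf⟩ := hdens
      rw [hf _ (measurableSet_singleton x),
        Measure.restrict_eq_zero.2 (sphereVolume_singleton hd x), lintegral_zero_measure]
    filter_upwards [ae_fst_ne hatom hZ hlaw hind] with ω hω n i
    refine sgn_ensemble_interpolates (hilbertKernel d) hK (fun j : Fin n => Z j ω)
      (fun j k hjk => ?_) i
    have : (j : ℕ) = k := by
      by_contra hne
      exact hω _ _ hne hjk
    rw [this]
  · refine tendstoInMeasure_risk hac
      (fun n => measurable_sgn_ensemble (measurable_hilbertKernel d) fun i => hZ i) ?_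
    have hdiff : ∀ s, ∀ᵐ x ∂(sphereVolume d), Tendsto (fun r => labelLaw μ s
        (Metric.closedBall x r) / sphereVolume d (Metric.closedBall x r)) (𝓝[>] 0)
          (𝓝 (labelDensity (sphereVolume d) μ s x)) := fun s => ae_tendsto_closedBall_div _
    have hfin : ∀ s, ∀ᵐ x ∂(sphereVolume d), labelDensity (sphereVolume d) μ s x < ⊤ :=
      fun s => Measure.rnDeriv_lt_top _ _
    filter_upwards [ae_all_iff.2 hdiff, ae_all_iff.2 hfin] with x hx hxT s hs
    exact tendsto_prob_sgn_ensemble_ne hd hZ hlaw hind s x (hxT s).ne hs (hx s) (hx (-s))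

end Consistency

end InterpolatingEnsemble

theorem mainTheorem3 (d : ℕ) (hd : 0 < d) (pH : PMF ℕ) (hpH : ∀ h, 0 < pH h) :
    -- away from the training points, the ensemble is the weighted average of the histograms
    (∀ (n : ℕ) (D : Fin n → Sphere d × ℤˣ) (x : Sphere d), (∀ i, (D i).1 ≠ x) →
      Integrable (fun θ => (hilbertArrangement d hd pH).α θ *
        histogram D ((hilbertArrangement d hd pH).part θ) x) (hilbertArrangement d hd pH).law ∧
      ensemble (hilbertArrangement d hd pH).kernel D x =
        ((∫ θ, (hilbertArrangement d hd pH).α θ *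
          histogram D ((hilbertArrangement d hd pH).part θ) x
            ∂(hilbertArrangement d hd pH).law : ℝ) : EReal)) ∧
    -- its sign interpolates every training set in which equal points carry equal labels
    (∀ (n : ℕ) (D : Fin n → Sphere d × ℤˣ), (∀ i j, (D i).1 = (D j).1 → (D i).2 = (D j).2) →
      ∀ i, sgn (ensemble (hilbertArrangement d hd pH).kernel D (D i).1) = (D i).2) ∧
    -- its sign has the interpolating-consistent property
    InterpolatingConsistent.{u} (sphereVolume d)
      (fun _ D x => sgn (ensemble (hilbertArrangement d hd pH).kernel D x)) := by
  have hkernel : (hilbertArrangement d hd pH).kernel = hilbertKernel d :=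
    funext fun x => funext fun z => kernel_hilbertArrangement hd pH hpH x z
  have htop : ∀ x z, (hilbertArrangement d hd pH).kernel x z = ⊤ ↔ x = z :=
    kernel_hilbertArrangement_eq_top_iff hd pH hpH
  refine ⟨fun n D x hx => ?_, fun n D hD i => sgn_ensemble_interpolates _ htop D hD i, ?_⟩
  · exact ensemble_eq_integral_histogram _ pH D x fun i h => hx i ((htop _ _).1 h).symm
  · rw [hkernel] at htop ⊢
    exact interpolatingConsistent_hilbertKernel hd htop
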